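/- **Setting.** Let $E$ be a complex Hilbert space of finite dimension $n$, $F$ a real Hilbert space of finite dimension $m$, $\Omega\subseteq F$ a non-empty open convex cone containing no affine line, and $\Phi\colon E\times E\to F_{\mathbb C}$ a non-degenerate hermitian map with $\Phi(\zeta):=\Phi(\zeta,\zeta)\in\overline\Omega$ for all $\zeta\in E$. Put $\rho(\zeta,z)=\operatorname{Im}z-\Phi(\zeta)$ and $D=\{(\zeta,z)\in E\times F_{\mathbb C}:\rho(\zeta,z)\in\Omega\}$. Assume that $D$ is homogeneous; equivalently, that there is a triangular (closed) subgroup $T_+$ of $GL(F)$ acting simply transitively on $\Omega$ such that for every $t\in T_+$ there is $g\in GL(E)$ with $t\circ\Phi=\Phi\circ(g\times g)$; fix such a $T_+$. Fix $e_\Omega\in\Omega$ and a surjective continuous homomorphism $\Delta\colon T_+\to(\mathbb R_+^*)^r$ with kernel $[T_+,T_+]$, with $\Delta(a\,\cdot\,)=(a,\dots,a)$ for all homotheties of ratio $a>0$, and such that, setting $\Delta_\Omega^{\mathbf s}(t\cdot e_\Omega)=\prod_{j=1}^r\Delta_j(t)^{s_j}$, the function $\Delta_\Omega^{\mathbf s}$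 ($\mathbf s\in\mathbb R^r$) is bounded on the bounded subsets of $\Omega$ if and only if $s_j\ge 0$ for all $j$. Integrals over $E$, $F$, $E\times F$ and $F_{\mathbb C}$ are with respect to Lebesgue measure. Let $\mathbf d,\mathbf b\in\mathbb R^r$ be the vectors such that $\nu_\Omega:=\Delta_\Omega^{\mathbf d}\cdot\mathrm{Leb}$ on $\Omega$ is invariant under all linear automorphisms of $\Omega$, and $(\Delta_\Omega^{\mathbf b+2\mathbf d}\circ\rho)\cdot\mathrm{Leb}$ on $D$ is invariant under all biholomorphisms of $D$. Let $\mathbf m\in\mathbb R^r$ be the vector such that, for $\mathbf s\in\mathbb R^r$, $\Delta_\Omega^{\mathbf s}\cdot\nu_\Omega$ induces a Radon measure on $F$ if and only if $s_j>m_j/2$ for all $j$. For $f$ on $D$, $h\in\Omega$ and $\zeta\in E$, let $f_h(\zeta,x)=f(\zeta,x+i\Phi(\zeta)+ih)$ for $(\zeta,x)\in E\times F$, and $f^{(\zeta)}(z)=f(\zeta,z+i\Phi(\zeta))$ for $z\in T_\Omega:=F+i\Omega$. For $p,q\in(0,\infty]$ and $\mathbf s\in\mathbb R^r$ let $\|g\|_{A^{p,q}_{\mathbf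 s}(T_\Omega)}=\big\|h\mapsto\Delta_\Omega^{\mathbf s}(h)\|g(\,\cdot\,+ih)\|_{L^p(F)}\big\|_{L^q(\nu_\Omega)}$ for $g$ holomorphic on $T_\Omega$, and define $$A^{p,q}_{\mathbf s}(D)=\big\{f\in\mathrm{Hol}(D):\big\|h\mapsto\Delta_\Omega^{\mathbf s}(h)\|f_h\|_{L^p(E\times F)}\big\|_{L^q(\nu_\Omega)}<\infty\big\},$$ $$\mathcal A^{p,q}_{\mathbf s}(D)=\big\{f\in\mathrm{Hol}(D):\big\|\zeta\mapsto\|f^{(\zeta)}\|_{A^{p,q}_{\mathbf s}(T_\Omega)}\big\|_{L^q(E)}<\infty\big\},$$ $$\mathfrak A^{p,q}_{\mathbf s}(D)=\big\{f\in\mathrm{Hol}(D):\big\|\zeta\mapsto\|f^{(\zeta)}\|_{A^{p,q}_{(\mathbf s+\mathbf b/2)/q}(T_\Omega)}\big\|_{L^q(E)}<\infty\big\},$$ with $(\mathbf s+\mathbf b/2)/q=\mathbf 0$ if $q=\infty$. **Lemma.** Let $p,q\in(0,\infty]$ and $\mathbf s\in\mathbb R^r$. (1) $\mathfrak A^{p,q}_{\mathbf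 s}(D)=\mathcal A^{p,q}_{(\mathbf s+\mathbf b/2)/q}(D)$. The same space is also given by $$\big\{f\in\mathrm{Hol}(D):\big\|h\mapsto\big\|\zeta\mapsto\|f_h(\zeta,\,\cdot\,)\|_{L^p(F)}\big\|_{L^q(E)}\big\|_{L^q(\Delta_\Omega^{\mathbf s+\mathbf b/2}\cdot\nu_\Omega)}<\infty\big\}.$$ (2) Assume that either $s_j>\frac1{2q}m_j$ for all $j$, or $q=\infty$ and $s_j\ge 0$ for all $j$. Then $A^{p,q}_{\mathbf s}(D)=\mathcal A^{p,q}_{\mathbf s}(D)$ if and only if $p=q$ or $E=\{0\}$. Moreover, if $p\ne q$ and $E\ne\{0\}$, then $A^{p,q}_{\mathbf s}(D)\not\subseteq\mathcal A^{p,q}_{\mathbf s}(D)$ and $\mathcal A^{p,q}_{\mathbf s}(D)\not\subseteq A^{p,q}_{\mathbf s}(D)$. -/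

import Mathlib

open MeasureTheory Set Bornology
open scoped ENNReal

set_option linter.unusedSectionVars false

noncomputable section

/-- The complexification `F_ℂ = F + iF` of a real Hilbert space `F`, with the Hilbert norm
`‖x + iy‖² = ‖x‖² + ‖y‖²`. -/
def Complexification (F : Type*) : Type _ := WithLp 2 (F × F)

namespace Complexification

variable {F : Type*} [NormedAddCommGroup F] [InnerProductSpace ℝ F]

instance : NormedAddCommGroup (Complexification F) :=
  inferInstanceAs (NormedAddCommGroup (WithLp 2 (F × F)))

/-- The element `x + iy` of `F_ℂ`. -/
def ofReIm (x y : F) : Complexification F := WithLp.toLp 2 (x, y)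

/-- The real part of an element of `F_ℂ`. -/
def re (z : Complexification F) : F := WithLp.fst (p := 2) (α := F) (β := F) z

/-- The imaginary part of an element of `F_ℂ`. -/
def im (z : Complexification F) : F := WithLp.snd (p := 2) (α := F) (β := F) z

@[simp] theorem re_ofReIm (x y : F) : (ofReIm x y).re = x := rfl
@[simp] theorem im_ofReIm (x y : F) : (ofReIm x y).im = y := rfl
@[simp] theorem ofReIm_re_im (z : Complexification F) : ofReIm z.re z.im = z := rfl
@[simp] theorem re_add (z w : Complexification F) : (z + w).re = z.re + w.re := rfl
@[simp] theorem im_add (z w : Complexification F) : (z + w).im = z.im + w.im := rfl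
@[simp] theorem re_zero : (0 : Complexification F).re = 0 := rfl
@[simp] theorem im_zero : (0 : Complexification F).im = 0 := rfl

@[ext] theorem ext {z w : Complexification F} (h₁ : z.re = w.re) (h₂ : z.im = w.im) : z = w := by
  rw [← ofReIm_re_im z, ← ofReIm_re_im w, h₁, h₂]

theorem norm_sq (z : Complexification F) : ‖z‖ ^ 2 = ‖z.re‖ ^ 2 + ‖z.im‖ ^ 2 :=
  WithLp.prod_norm_sq_eq_of_L2 (α := F) (β := F) z

/-- `(a + ib)(x + iy) = (ax - by) + i(ay + bx)`. -/
instance : SMul ℂ (Complexification F) where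
  smul c z := ofReIm (c.re • z.re - c.im • z.im) (c.re • z.im + c.im • z.re)

@[simp] theorem re_smul (c : ℂ) (z : Complexification F) :
    (c • z).re = c.re • z.re - c.im • z.im := rfl
@[simp] theorem im_smul (c : ℂ) (z : Complexification F) :
    (c • z).im = c.re • z.im + c.im • z.re := rfl

instance : Module ℂ (Complexification F) where
  one_smul z := by ext <;> simp
  mul_smul a b z := by ext <;> simp <;> module
  smul_zero a := by ext <;> simp
  smul_add a z w := by ext <;> simp <;> module
  add_smul a b z := by ext <;> simp <;> module
  zero_smul z := by ext <;> simp

instance : NormedSpace ℂ (Complexification F) where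
  norm_smul_le c z := by
    refine le_of_eq ?_
    rw [← sq_eq_sq₀ (norm_nonneg _) (by positivity), mul_pow, norm_sq, norm_sq, re_smul, im_smul,
      norm_sub_sq_real, norm_add_sq_real, Complex.sq_norm, Complex.normSq_apply]
    simp only [norm_smul, mul_pow, Real.norm_eq_abs, sq_abs, real_inner_smul_left,
      real_inner_smul_right]
    rw [real_inner_comm z.re z.im]
    ring

instance : MeasurableSpace (Complexification F) := borel _

instance : BorelSpace (Complexification F) := ⟨rfl⟩

/-- Complex conjugation `x + iy ↦ x - iy`. -/
def conj (z : Complexification F) : Complexification F := ofReIm z.re (-z.im)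

/-- Lebesgue measure `dx dy` on `F_ℂ`. -/
def lebesgue [FiniteDimensional ℝ F] [MeasurableSpace F] [BorelSpace F] :
    Measure (Complexification F) :=
  ((volume : Measure F).prod volume).map (fun w => ofReIm w.1 w.2)

end Complexification

open Complexification (ofReIm)

/-- Lebesgue measure on a finite-dimensional complex Hilbert space `E`, for the underlying real
Hilbert space. -/
def complexLebesgue (E : Type*) [NormedAddCommGroup E] [InnerProductSpace ℂ E]
    [FiniteDimensional ℂ E] [MeasurableSpace E] [BorelSpace E] : Measure E :=
  letI : InnerProductSpace ℝ E := InnerProductSpace.rclikeToReal ℂ E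
  haveI : FiniteDimensional ℝ E := FiniteDimensional.complexToReal E
  volume

/-- The data of a Siegel domain of type II: an open convex cone `Ω ≠ ∅` in `F` which contains no
affine line, and a non-degenerate hermitian map `Φ : E × E → F_ℂ` such that `Φ(ζ, ζ)` lies in the
closure of `Ω` for every `ζ`. -/
structure SiegelDomain (E F : Type*) [NormedAddCommGroup E] [InnerProductSpace ℂ E]
    [NormedAddCommGroup F] [InnerProductSpace ℝ F] where
  /-- the cone `Ω` -/
  Ω : ConvexCone ℝ F
  isOpen_Ω : IsOpen (Ω : Set F)
  nonempty_Ω : (Ω : Set F).Nonempty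
  no_line : ∀ x v : F, (∀ a : ℝ, x + a • v ∈ Ω) → v = 0
  /-- the hermitian map `Φ`, linear in the first variable and antilinear in the second -/
  Φ : E →ₗ[ℂ] E →ₗ⋆[ℂ] Complexification F
  hermitian : ∀ ζ ζ' : E, Φ ζ' ζ = (Φ ζ ζ').conj
  nondegenerate : ∀ ζ : E, (∀ ζ' : E, Φ ζ ζ' = 0) → ζ = 0
  positive : ∀ ζ : E, (Φ ζ ζ).re ∈ closure (Ω : Set F)

namespace SiegelDomain

variable {E F : Type*} [NormedAddCommGroup E] [InnerProductSpace ℂ E]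
  [NormedAddCommGroup F] [InnerProductSpace ℝ F]

/-- `Φ(ζ) = Φ(ζ, ζ)`, an element of `F` (its imaginary part vanishes as `Φ` is hermitian). -/
def quad (S : SiegelDomain E F) (ζ : E) : F := (S.Φ ζ ζ).re

/-- `ρ(ζ, z) = Im z - Φ(ζ)`. -/
def rho (S : SiegelDomain E F) (w : E × Complexification F) : F := w.2.im - S.quad w.1

/-- The Siegel domain `D = {(ζ, z) : Im z - Φ(ζ) ∈ Ω}`. -/
def domain (S : SiegelDomain E F) : Set (E × Complexification F) := {w | S.rho w ∈ S.Ω}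

/-- A triangular closed subgroup `T₊` of `GL(F)` which acts simply transitively on `Ω` and such
that for every `t ∈ T₊` there is `g ∈ GL(E)` with `t ∘ Φ = Φ ∘ (g × g)`.  (The domain is homogeneous
exactly when such a group exists.) -/
structure TriangularGroup (S : SiegelDomain E F) where
  /-- the group `T₊` -/
  T : Subgroup (F →L[ℝ] F)ˣ
  isClosed_T : IsClosed (T : Set (F →L[ℝ] F)ˣ)
  /-- in some basis of `F` every element of `T₊` is upper triangular -/
  triangular : ∃ β : Module.Basis (Fin (Module.finrank ℝ F)) ℝ F,
    ∀ t ∈ T, ∀ i j, j < i → β.repr ((t : F →L[ℝ] F) (β j)) i = 0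
  mapsTo : ∀ t ∈ T, ∀ x ∈ S.Ω, (t : F →L[ℝ] F) x ∈ S.Ω
  simply_transitive : ∀ x ∈ S.Ω, ∀ y ∈ S.Ω, ∃! t : T, ((t : (F →L[ℝ] F)ˣ) : F →L[ℝ] F) x = y
  lift : ∀ t ∈ T, ∃ g : E ≃ₗ[ℂ] E, ∀ ζ ζ' : E,
    ofReIm ((t : F →L[ℝ] F) (S.Φ ζ ζ').re) ((t : F →L[ℝ] F) (S.Φ ζ ζ').im) = S.Φ (g ζ) (g ζ')

namespace TriangularGroup

variable {S : SiegelDomain E F}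

/-- A base point `e_Ω ∈ Ω` and a surjective continuous homomorphism
`Δ : T₊ → (ℝ₊*)ʳ` with kernel `[T₊, T₊]`, such that `Δ(a ·) = (a, …, a)` for every homothety and
such that `t · e_Ω ↦ Δˢ(t)` is bounded on the bounded subsets of `Ω` if and only if `s ∈ ℝ₊ʳ`.
(These conditions determine `r`, and `Δ` up to a permutation of its components.) -/
structure PowerCharacter (G : S.TriangularGroup) (r : ℕ) where
  /-- the base point `e_Ω` -/
  e : F
  e_mem : e ∈ S.Ω
  /-- the homomorphism `Δ` -/
  Δ : G.T →* (Fin r → {x : ℝ // 0 < x})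
  continuous_Δ : Continuous Δ
  surjective_Δ : Function.Surjective Δ
  ker_Δ : Δ.ker = commutator G.T
  homothety : ∀ a : ℝ, 0 < a → ∃ t : G.T,
    (∀ x : F, ((t : (F →L[ℝ] F)ˣ) : F →L[ℝ] F) x = a • x) ∧ ∀ j, (Δ t j : ℝ) = a
  bounded_iff : ∀ s : Fin r → ℝ,
    (∀ B : Set F, B ⊆ S.Ω → IsBounded B → ∃ C : ℝ, ∀ t : G.T,
      ((t : (F →L[ℝ] F)ˣ) : F →L[ℝ] F) e ∈ B → ∏ j, (Δ t j : ℝ) ^ s j ≤ C) ↔ ∀ j, 0 ≤ s j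

namespace PowerCharacter

variable {G : S.TriangularGroup} {r : ℕ}

open Classical in
/-- The element `t` of `T₊` such that `t · e_Ω = h`, for `h ∈ Ω` (and `1` for `h ∉ Ω`). -/
def orbitInv (P : G.PowerCharacter r) (h : F) : G.T :=
  if hh : h ∈ S.Ω then (G.simply_transitive P.e P.e_mem h hh).choose else 1

/-- The generalized power function `Δ_Ωˢ`, given on `Ω` by `Δ_Ωˢ(t · e_Ω) = ∏ⱼ Δⱼ(t) ^ sⱼ`. -/
def power (P : G.PowerCharacter r) (s : Fin r → ℝ) (h : F) : ℝ :=
  ∏ j, (P.Δ (P.orbitInv h) j : ℝ) ^ s j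

theorem power_smul (P : G.PowerCharacter r) (s : Fin r → ℝ) (t : G.T) :
    P.power s (((t : (F →L[ℝ] F)ˣ) : F →L[ℝ] F) P.e) = ∏ j, (P.Δ t j : ℝ) ^ s j := by
  have hh := G.mapsTo _ t.2 _ P.e_mem
  have key : P.orbitInv (((t : (F →L[ℝ] F)ˣ) : F →L[ℝ] F) P.e) = t := by
    rw [orbitInv, dif_pos hh]
    exact (G.simply_transitive P.e P.e_mem _ hh).unique
      (G.simply_transitive P.e P.e_mem _ hh).choose_spec.1 rfl
  rw [power, key]

variable [FiniteDimensional ℂ E] [MeasurableSpace E] [BorelSpace E]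
  [FiniteDimensional ℝ F] [MeasurableSpace F] [BorelSpace F]

/-- The measure `ν_Ω = Δ_Ωᵈ · Lebesgue` on `Ω`, regarded as a measure on `F` vanishing off `Ω`. -/
def coneMeasure (P : G.PowerCharacter r) (d : Fin r → ℝ) : Measure F :=
  (volume.restrict (S.Ω : Set F)).withDensity (fun h => ENNReal.ofReal (P.power d h))

/-- The measure `ν_D = (Δ_Ω^{b + 2d} ∘ ρ) · Lebesgue` on `D`, regarded as a measure on `E × F_ℂ`
vanishing off `D`. -/
def domainMeasure (P : G.PowerCharacter r) (d b : Fin r → ℝ) :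
    Measure (E × Complexification F) :=
  (((complexLebesgue E).prod Complexification.lebesgue).restrict S.domain).withDensity
    (fun w => ENNReal.ofReal (P.power (b + (2 : ℝ) • d) (S.rho w)))

/-- The defining property of the vectors `d` and `b`: `ν_Ω` is invariant under all linear
automorphisms of `Ω`, and `ν_D` is invariant under all biholomorphisms of `D`. -/
structure IsInvariantExponents (P : G.PowerCharacter r) (d b : Fin r → ℝ) : Prop where
  cone : ∀ A : F ≃L[ℝ] F, A '' (S.Ω : Set F) = S.Ω →
    (P.coneMeasure d).map A = P.coneMeasure d
  domain : ∀ φ ψ : E × Complexification F → E × Complexification F,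
    DifferentiableOn ℂ φ S.domain → DifferentiableOn ℂ ψ S.domain →
    MapsTo φ S.domain S.domain → MapsTo ψ S.domain S.domain → InvOn ψ φ S.domain S.domain →
    ∀ B ⊆ S.domain, MeasurableSet B →
      P.domainMeasure d b (φ '' B) = P.domainMeasure d b B

/-- The defining property of the vector `m`: `Δ_Ωˢ · ν_Ω` induces a Radon (that is, locally
finite) measure on `F` if and only if `sⱼ > mⱼ / 2` for every `j`. -/
def IsRadonExponent (P : G.PowerCharacter r) (d m : Fin r → ℝ) : Prop :=
  ∀ s : Fin r → ℝ,
    IsLocallyFiniteMeasure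
      ((P.coneMeasure d).withDensity (fun h => ENNReal.ofReal (P.power s h))) ↔
    ∀ j, m j / 2 < s j

/-- `f_h(ζ, x) = f(ζ, x + iΦ(ζ) + ih)`, a function on `𝒩 = E × F`. -/
def _root_.SiegelDomain.slice (S : SiegelDomain E F) (f : E × Complexification F → ℂ) (h : F)
    (n : E × F) : ℂ :=
  f (n.1, ofReIm n.2 (S.quad n.1 + h))

/-- `f^{(ζ)}(z) = f(ζ, z + iΦ(ζ))`, a function on the tube domain `T_Ω = F + iΩ`. -/
def _root_.SiegelDomain.tubeSlice (S : SiegelDomain E F) (f : E × Complexification F → ℂ) (ζ : E)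
    (z : Complexification F) : ℂ :=
  f (ζ, z + ofReIm 0 (S.quad ζ))

/-- The quasi-norm of `A^{p,q}_s(D)`: `‖h ↦ Δ_Ωˢ(h) ‖f_h‖_{Lᵖ(𝒩)}‖_{L^q(ν_Ω)}`. -/
def bergmanNorm (P : G.PowerCharacter r) (d : Fin r → ℝ) (p q : ℝ≥0∞) (s : Fin r → ℝ)
    (f : E × Complexification F → ℂ) : ℝ≥0∞ :=
  eLpNorm (fun h : F => ENNReal.ofReal (P.power s h) *
    eLpNorm (S.slice f h) p ((complexLebesgue E).prod (volume : Measure F))) q (P.coneMeasure d)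

/-- The quasi-norm of `A^{p,q}_s(T_Ω)`: `‖h ↦ Δ_Ωˢ(h) ‖g(· + ih)‖_{Lᵖ(F)}‖_{L^q(ν_Ω)}`. -/
def tubeNorm (P : G.PowerCharacter r) (d : Fin r → ℝ) (p q : ℝ≥0∞) (s : Fin r → ℝ)
    (g : Complexification F → ℂ) : ℝ≥0∞ :=
  eLpNorm (fun h : F => ENNReal.ofReal (P.power s h) *
    eLpNorm (fun x : F => g (ofReIm x h)) p volume) q (P.coneMeasure d)

/-- The space `A^{p,q}_s(D)`.  Functions on `D` are represented by functions on `E × F_ℂ`, whose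
values off `D` are irrelevant. -/
def bergmanA (P : G.PowerCharacter r) (d : Fin r → ℝ) (p q : ℝ≥0∞) (s : Fin r → ℝ) :
    Set (E × Complexification F → ℂ) :=
  {f | DifferentiableOn ℂ f S.domain ∧ P.bergmanNorm d p q s f < ∞}

/-- The space `𝒜^{p,q}_s(D)`: `f` is holomorphic and
`‖ζ ↦ ‖f^{(ζ)}‖_{A^{p,q}_s(T_Ω)}‖_{L^q(E)} < ∞`. -/
def bergmanCal (P : G.PowerCharacter r) (d : Fin r → ℝ) (p q : ℝ≥0∞) (s : Fin r → ℝ) :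
    Set (E × Complexification F → ℂ) :=
  {f | DifferentiableOn ℂ f S.domain ∧
    eLpNorm (fun ζ : E => P.tubeNorm d p q s (S.tubeSlice f ζ)) q (complexLebesgue E) < ∞}

/-- The index `(s + b/2)/q`, which is `0` for `q = ∞`. -/
def shiftedIndex (b : Fin r → ℝ) (q : ℝ≥0∞) (s : Fin r → ℝ) : Fin r → ℝ :=
  q⁻¹.toReal • (s + (1 / 2 : ℝ) • b)

/-- The space `𝔄^{p,q}_s(D)`: `f` is holomorphic and
`‖ζ ↦ ‖f^{(ζ)}‖_{A^{p,q}_{(s+b/2)/q}(T_Ω)}‖_{L^q(E)} < ∞`. -/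
def bergmanFrak (P : G.PowerCharacter r) (d b : Fin r → ℝ) (p q : ℝ≥0∞) (s : Fin r → ℝ) :
    Set (E × Complexification F → ℂ) :=
  {f | DifferentiableOn ℂ f S.domain ∧
    eLpNorm (fun ζ : E => P.tubeNorm d p q (shiftedIndex b q s) (S.tubeSlice f ζ)) q (complexLebesgue E) < ∞}

/-- The mixed norm `‖g‖_{L^{p,q}(F,E)} = ‖ζ ↦ ‖g(ζ, ·)‖_{Lᵖ(F)}‖_{L^q(E)}`. -/
def mixedNorm (p q : ℝ≥0∞) (g : E × F → ℂ) : ℝ≥0∞ :=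
  eLpNorm (fun ζ : E => eLpNorm (fun x : F => g (ζ, x)) p volume) q (complexLebesgue E)

/-- The other description of `𝔄^{p,q}_s(D)`, in which the weight multiplies the measure: `f` is
holomorphic and `‖h ↦ ‖f_h‖_{L^{p,q}(F,E)}‖_{L^q(Δ_Ω^{s+b/2} · ν_Ω)} < ∞`. -/
def bergmanFrakWeighted (P : G.PowerCharacter r) (d b : Fin r → ℝ) (p q : ℝ≥0∞)
    (s : Fin r → ℝ) : Set (E × Complexification F → ℂ) :=
  {f | DifferentiableOn ℂ f S.domain ∧
    eLpNorm (fun h : F => mixedNorm p q (S.slice f h)) q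
      ((P.coneMeasure d).withDensity
        (fun h => ENNReal.ofReal (P.power (s + (1 / 2 : ℝ) • b) h))) < ∞}

end PowerCharacter

end TriangularGroup

end SiegelDomain

end

/-! In the coordinates `(ζ, x, h)` with `z = x + i(Φ(ζ) + h)`, all the quasi-norms become iterated
`L^p` and `L^q` quasi-norms over `E`, `F` and the cone. In `𝒜` the two outer norms carry the same
exponent `q`, so Tonelli interchanges them. This gives part (1), and also the equality in part (2)
when `p = q`; if `E` is a point, the norm over `E` is only a constant factor.

For `p ≠ q` and `E ≠ 0` the obstruction is homogeneity. The dilations `(ζ, x, h) ↦ (√a ζ, a x, a h)`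
scale the norms of `A` and `𝒜` by powers of `a` whose exponents differ by `dim_ℂ E · (1/p - 1/q)`,
which is not zero. A lacunary sum of dilates of one holomorphic function then has one norm finite
and the other infinite, and the roles may be exchanged.

The building block is `∏ₗ (1 - i l(z))^(-M)`, where `l` runs over finitely many functionals positive
on `Ω` and separating the points of `F`. For large `M` it decays fast enough in all three variables
to have finite norm (`exists_coord_kernel_le`, `exists_coneNorm_decay_lt_top`). Near the origin,
finiteness is the assumption on `s` (`coneNorm_unitBall_lt_top`). Cancellation between dilates is
excluded on a dilation-invariant sector around `x = 0`, where all of them have real part at least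
half their modulus (`norm_halfPlaneKernel_le_two_mul_re`). There the sum dominates each of its terms
up to a factor 2, and the terms have unbounded second norm. `exists_holomorphic_separating` carries
out this argument for any two norms satisfying `IsDilationNorm`. -/

noncomputable section

/-! ### Quasi-norms of `[0, ∞]`-valued functions, for all exponents in `(0, ∞]`. -/

section MixedNorms

variable {X Y : Type*} [MeasurableSpace X] [MeasurableSpace Y]

theorem eLpNorm_ennreal_of_ne_top {p : ℝ≥0∞} (hp : p ≠ 0) (hp' : p ≠ ∞) (μ : Measure X)
    (g : X → ℝ≥0∞) :
    eLpNorm g p μ = (∫⁻ x, g x ^ p.toReal ∂μ) ^ (1 / p.toReal) := by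
  simp [eLpNorm_eq_lintegral_rpow_enorm_toReal hp hp']

theorem eLpNorm_ennreal_top (μ : Measure X) (g : X → ℝ≥0∞) :
    eLpNorm g ∞ μ = essSup g μ := by
  simp [eLpNorm_exponent_top, eLpNormEssSup]

theorem eLpNorm_ennreal_mono {p : ℝ≥0∞} {μ : Measure X} {g g' : X → ℝ≥0∞} (h : ∀ x, g x ≤ g' x) :
    eLpNorm g p μ ≤ eLpNorm g' p μ :=
  eLpNorm_mono_enorm (by simpa using h)

theorem eLpNorm_ennreal_mono_ae {p : ℝ≥0∞} {μ : Measure X} {g g' : X → ℝ≥0∞}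
    (h : ∀ᵐ x ∂μ, g x ≤ g' x) : eLpNorm g p μ ≤ eLpNorm g' p μ :=
  eLpNorm_mono_enorm_ae (by simpa using h)

theorem eLpNorm_ennreal_const_mul {p : ℝ≥0∞} (hp : p ≠ 0) (μ : Measure X) {c : ℝ≥0∞} (hc : c ≠ ∞)
    (g : X → ℝ≥0∞) : eLpNorm (fun x => c * g x) p μ = c * eLpNorm g p μ := by
  by_cases hp' : p = ∞
  · subst hp'
    rw [eLpNorm_ennreal_top, eLpNorm_ennreal_top, ENNReal.essSup_const_mul]
  · have h0 : 0 < p.toReal := ENNReal.toReal_pos hp hp'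
    rw [eLpNorm_ennreal_of_ne_top hp hp', eLpNorm_ennreal_of_ne_top hp hp']
    simp_rw [ENNReal.mul_rpow_of_nonneg _ _ h0.le]
    rw [lintegral_const_mul' _ _ (ENNReal.rpow_ne_top_of_nonneg h0.le hc),
      ENNReal.mul_rpow_of_nonneg _ _ (by positivity), ← ENNReal.rpow_mul,
      mul_one_div_cancel h0.ne', ENNReal.rpow_one]

theorem eLpNorm_ennreal_mul_const {p : ℝ≥0∞} (hp : p ≠ 0) (μ : Measure X) {c : ℝ≥0∞} (hc : c ≠ ∞)
    (g : X → ℝ≥0∞) : eLpNorm (fun x => g x * c) p μ = eLpNorm g p μ * c := by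
  simp_rw [mul_comm _ c]
  exact eLpNorm_ennreal_const_mul hp μ hc g

/-- For `p = ∞`, the essential supremum of a slice exceeds `c` exactly when the slice of `{g > c}`
has positive measure, and measures of slices depend measurably on the base point. -/
theorem measurable_eLpNorm_ennreal {p : ℝ≥0∞} (hp : p ≠ 0) (ν : Measure Y) [SFinite ν]
    {g : X → Y → ℝ≥0∞} (hg : Measurable (Function.uncurry g)) :
    Measurable (fun x => eLpNorm (g x) p ν) := by
  by_cases hp' : p = ∞
  · subst hp'
    simp_rw [eLpNorm_ennreal_top]
    refine measurable_of_Ioi fun c => ?_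
    have : (fun x => essSup (g x) ν) ⁻¹' Ioi c =
        {x | 0 < ν (Prod.mk x ⁻¹' {z : X × Y | c < g z.1 z.2})} := by
      ext x
      simp only [mem_preimage, mem_Ioi, mem_ofPred_eq]
      constructor
      · intro h
        rw [pos_iff_ne_zero]
        intro h0
        refine absurd h (not_lt.2 (essSup_le_of_ae_le c ?_))
        rw [Filter.EventuallyLE, ae_iff]
        simpa using h0
      · intro h
        by_contra! hc
        have h1 : ∀ᵐ y ∂ν, g x y ≤ c := by
          filter_upwards [ENNReal.ae_le_essSup (μ := ν) (g x)] with y hy using hy.trans hc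
        rw [ae_iff] at h1
        simp only [not_le] at h1
        exact h.ne' h1
    rw [this]
    refine measurableSet_lt measurable_const (measurable_measure_prodMk_left ?_)
    exact measurableSet_lt measurable_const hg
  · simp_rw [eLpNorm_ennreal_of_ne_top hp hp']
    exact (Measurable.lintegral_prod_right (hg.pow_const _)).pow_const _

theorem essSup_ennreal_prod (μ : Measure X) (ν : Measure Y) [SFinite μ] [SFinite ν]
    {g : X × Y → ℝ≥0∞} (hg : Measurable g) :
    essSup g (μ.prod ν) = essSup (fun x => essSup (fun y => g (x, y)) ν) μ := by
  apply le_antisymm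
  · refine essSup_le_of_ae_le _ ?_
    have hS : MeasurableSet {z : X × Y | g z ≤ essSup (fun x => essSup (fun y => g (x, y)) ν) μ} :=
      measurableSet_le hg measurable_const
    refine (Measure.ae_prod_iff_ae_ae hS).2 ?_
    filter_upwards [ENNReal.ae_le_essSup (μ := μ) (fun x => essSup (fun y => g (x, y)) ν)] with x hx
    filter_upwards [ENNReal.ae_le_essSup (μ := ν) (fun y => g (x, y))] with y hy using hy.trans hx
  · refine essSup_le_of_ae_le _ ?_
    have h := Measure.ae_ae_of_ae_prod (ENNReal.ae_le_essSup (μ := μ.prod ν) g)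
    filter_upwards [h] with x hx using essSup_le_of_ae_le _ hx

/-- Tonelli's theorem for `Lᵖ` quasi-norms, for every exponent. -/
theorem eLpNorm_ennreal_prod {p : ℝ≥0∞} (hp : p ≠ 0) (μ : Measure X) (ν : Measure Y) [SFinite μ]
    [SFinite ν] {g : X × Y → ℝ≥0∞} (hg : Measurable g) :
    eLpNorm g p (μ.prod ν) = eLpNorm (fun x => eLpNorm (fun y => g (x, y)) p ν) p μ := by
  by_cases hp' : p = ∞
  · subst hp'
    simp_rw [eLpNorm_ennreal_top]
    exact essSup_ennreal_prod μ ν hg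
  · have h0 : 0 < p.toReal := ENNReal.toReal_pos hp hp'
    simp_rw [eLpNorm_ennreal_of_ne_top hp hp']
    simp_rw [← ENNReal.rpow_mul, one_div_mul_cancel h0.ne', ENNReal.rpow_one]
    rw [lintegral_prod _ (hg.pow_const _).aemeasurable]

theorem eLpNorm_ennreal_swap {p : ℝ≥0∞} (hp : p ≠ 0) (μ : Measure X) (ν : Measure Y) [SFinite μ]
    [SFinite ν] {g : X → Y → ℝ≥0∞} (hg : Measurable (Function.uncurry g)) :
    eLpNorm (fun x => eLpNorm (fun y => g x y) p ν) p μ =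
      eLpNorm (fun y => eLpNorm (fun x => g x y) p μ) p ν := by
  have hg' : Measurable (fun z : Y × X => g z.2 z.1) := hg.comp measurable_swap
  rw [← eLpNorm_ennreal_prod hp ν μ hg']
  rw [← eLpNorm_ennreal_prod hp μ ν (g := fun z => g z.1 z.2) hg]
  rw [← Measure.prod_swap (μ := ν) (ν := μ), eLpNorm_map_measure]
  · rfl
  · exact Measurable.aestronglyMeasurable hg
  · exact measurable_swap.aemeasurable

/-- For `p = ∞` the exponent of `w` is `0`, and nonvanishing of `w` is what makes the two measures
have the same null sets. -/
theorem eLpNorm_ennreal_withDensity {p : ℝ≥0∞} (hp : p ≠ 0) (μ : Measure X) {w g : X → ℝ≥0∞}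
    (hw : Measurable w) (hg : Measurable g) (hw0 : ∀ x, w x ≠ 0) :
    eLpNorm g p (μ.withDensity w) = eLpNorm (fun x => w x ^ p⁻¹.toReal * g x) p μ := by
  by_cases hp' : p = ∞
  · subst hp'
    simp_rw [eLpNorm_ennreal_top]
    have h1 : μ.withDensity w ≪ μ := withDensity_absolutelyContinuous _ _
    have h2 : μ ≪ μ.withDensity w :=
      withDensity_absolutelyContinuous' hw.aemeasurable (Filter.Eventually.of_forall hw0)
    simpa using le_antisymm (essSup_mono_measure h1) (essSup_mono_measure h2)
  · have h0 : 0 < p.toReal := ENNReal.toReal_pos hp hp'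
    simp_rw [eLpNorm_ennreal_of_ne_top hp hp', ENNReal.mul_rpow_of_nonneg _ _ h0.le,
      ← ENNReal.rpow_mul, ENNReal.toReal_inv, inv_mul_cancel₀ h0.ne', ENNReal.rpow_one]
    rw [lintegral_withDensity_eq_lintegral_mul _ hw (hg.pow_const _)]
    rfl

theorem eLpNorm_ennreal_ne_zero {p : ℝ≥0∞} (hp : p ≠ 0) {μ : Measure X} {g : X → ℝ≥0∞}
    (hg : Measurable g) {A : Set X} (hA : μ A ≠ 0) (h : ∀ x ∈ A, g x ≠ 0) : eLpNorm g p μ ≠ 0 := by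
  rw [Ne, eLpNorm_eq_zero_iff hg.aestronglyMeasurable hp]
  intro h0
  refine hA (measure_mono_null ?_ (ae_iff.1 h0))
  intro x hx
  exact h x hx

/-- The constant in `eLpNorm_ennreal_tsum_le`. -/
def tsumConst (p : ℝ≥0∞) : ℝ≥0∞ := 2 * (∑' k : ℕ, ((2⁻¹ : ℝ≥0∞) ^ k) ^ p.toReal) ^ (1 / p.toReal) + 2

theorem tsumConst_ne_top {p : ℝ≥0∞} (hp : p ≠ 0) : tsumConst p ≠ ∞ := by
  unfold tsumConst
  by_cases hp' : p = ∞
  · subst hp'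
    -- At `p = ∞` the inner series diverges, but it is raised to the power `1 / 0 = 0`.
    simp
  have h0 : 0 < p.toReal := ENNReal.toReal_pos hp hp'
  refine ENNReal.add_ne_top.2 ⟨ENNReal.mul_ne_top (by simp)
    (ENNReal.rpow_ne_top_of_nonneg (by positivity) ?_), by simp⟩
  have : ∀ k : ℕ, ((2⁻¹ : ℝ≥0∞) ^ k) ^ p.toReal = ((2⁻¹ : ℝ≥0∞) ^ p.toReal) ^ k := fun k => by
    rw [← ENNReal.rpow_natCast, ← ENNReal.rpow_mul, mul_comm, ENNReal.rpow_mul,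
      ENNReal.rpow_natCast]
  simp_rw [this]
  rw [ENNReal.tsum_geometric]
  simp only [ne_eq, ENNReal.inv_eq_top, tsub_eq_zero_iff_le, not_le]
  exact ENNReal.rpow_lt_one (by simp) h0

theorem tsum_two_inv_mul_le (a : ℕ → ℝ≥0∞) : ∑' k, a k ≤ 2 * ⨆ k, 2 ^ k * a k := by
  have h : ∀ k, a k ≤ 2⁻¹ ^ k * ⨆ k, 2 ^ k * a k := fun k => by
    calc a k = 2⁻¹ ^ k * (2 ^ k * a k) := by
          rw [← mul_assoc, ← mul_pow, ENNReal.inv_mul_cancel (by simp) (by simp), one_pow, one_mul]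
      _ ≤ _ := by gcongr; exact le_iSup (fun k => 2 ^ k * a k) k
  refine (ENNReal.tsum_le_tsum h).trans ?_
  rw [ENNReal.tsum_mul_right, ENNReal.tsum_geometric_two]

/-- This replaces the countable triangle inequality, which fails for `p < 1`. One factor `2 ^ k` of
the weight is spent on bounding the sum by a supremum, the other on summing the `p`-th powers that
bound the `p`-th power of that supremum. -/
theorem eLpNorm_ennreal_tsum_le {p : ℝ≥0∞} (hp : p ≠ 0) (μ : Measure X) {g : ℕ → X → ℝ≥0∞}
    (hg : ∀ k, Measurable (g k)) :
    eLpNorm (fun x => ∑' k, g k x) p μ ≤ tsumConst p * ∑' k, 4 ^ k * eLpNorm (g k) p μ := by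
  have hle : ∀ k, 4 ^ k * eLpNorm (g k) p μ ≤ ∑' k, 4 ^ k * eLpNorm (g k) p μ :=
    fun k => ENNReal.le_tsum k
  by_cases hp' : p = ∞
  · subst hp'
    have hc : (1 : ℝ≥0∞) ≤ tsumConst ∞ := by
      unfold tsumConst; exact le_add_left (by norm_num)
    refine le_trans ?_ (le_mul_of_one_le_left' hc)
    simp_rw [eLpNorm_ennreal_top]
    refine essSup_le_of_ae_le _ ?_
    have h := ae_all_iff.2 fun k => ENNReal.ae_le_essSup (μ := μ) (g k)
    filter_upwards [h] with x hx
    refine ENNReal.tsum_le_tsum fun k => (hx k).trans ?_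
    exact le_mul_of_one_le_left' (one_le_pow₀ (by norm_num))
  · have h0 : 0 < p.toReal := ENNReal.toReal_pos hp hp'
    set T := ∑' k, 4 ^ k * eLpNorm (g k) p μ
    have h1 : eLpNorm (fun x => ∑' k, g k x) p μ ≤ 2 * eLpNorm (fun x => ⨆ k, 2 ^ k * g k x) p μ := by
      rw [← eLpNorm_ennreal_const_mul hp μ (by simp)]
      exact eLpNorm_ennreal_mono fun x => tsum_two_inv_mul_le _
    refine h1.trans ?_
    have h2 : ∫⁻ x, (⨆ k, 2 ^ k * g k x) ^ p.toReal ∂μ ≤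
        (∑' k : ℕ, ((2⁻¹ : ℝ≥0∞) ^ k) ^ p.toReal) * T ^ p.toReal := by
      calc ∫⁻ x, (⨆ k, 2 ^ k * g k x) ^ p.toReal ∂μ
          ≤ ∫⁻ x, ∑' k, (2 ^ k * g k x) ^ p.toReal ∂μ := by
            refine lintegral_mono fun x => ?_
            rw [← ENNReal.orderIsoRpow_apply _ h0, OrderIso.map_iSup]
            exact iSup_le fun k => ENNReal.le_tsum (f := fun k => (2 ^ k * g k x) ^ p.toReal) k
        _ = ∑' k, ∫⁻ x, (2 ^ k * g k x) ^ p.toReal ∂μ :=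
            lintegral_tsum fun k => (((hg k).const_mul _).pow_const _).aemeasurable
        _ ≤ ∑' k : ℕ, ((2⁻¹ : ℝ≥0∞) ^ k) ^ p.toReal * T ^ p.toReal := by
            refine ENNReal.tsum_le_tsum fun k => ?_
            have e : ∫⁻ x, (2 ^ k * g k x) ^ p.toReal ∂μ =
                (2 ^ k * eLpNorm (g k) p μ) ^ p.toReal := by
              rw [← eLpNorm_ennreal_const_mul hp μ (by simp), eLpNorm_ennreal_of_ne_top hp hp',
                ← ENNReal.rpow_mul, one_div_mul_cancel h0.ne', ENNReal.rpow_one]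
            rw [e, ← ENNReal.mul_rpow_of_nonneg _ _ h0.le]
            refine ENNReal.rpow_le_rpow ?_ h0.le
            calc 2 ^ k * eLpNorm (g k) p μ = 2⁻¹ ^ k * (4 ^ k * eLpNorm (g k) p μ) := by
                  rw [← mul_assoc, ← mul_pow, show (4 : ℝ≥0∞) = 2 * 2 by norm_num, ← mul_assoc,
                    ENNReal.inv_mul_cancel (by simp) (by simp), one_mul]
              _ ≤ _ := by gcongr; exact hle k
        _ = _ := ENNReal.tsum_mul_right
    rw [eLpNorm_ennreal_of_ne_top hp hp']
    calc 2 * (∫⁻ x, (⨆ k, 2 ^ k * g k x) ^ p.toReal ∂μ) ^ (1 / p.toReal)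
        ≤ 2 * ((∑' k : ℕ, ((2⁻¹ : ℝ≥0∞) ^ k) ^ p.toReal) * T ^ p.toReal) ^ (1 / p.toReal) := by
          gcongr
      _ = 2 * (∑' k : ℕ, ((2⁻¹ : ℝ≥0∞) ^ k) ^ p.toReal) ^ (1 / p.toReal) * T := by
          rw [ENNReal.mul_rpow_of_nonneg _ _ (by positivity), ← ENNReal.rpow_mul,
            mul_one_div_cancel h0.ne', ENNReal.rpow_one, mul_assoc]
      _ ≤ tsumConst p * T := by gcongr; exact le_self_add

/-- Change of variables for a measurable bijection which multiplies the measure by a constant. -/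
theorem eLpNorm_ennreal_comp {p : ℝ≥0∞} {μ : Measure X} {ν : Measure Y} (e : X ≃ᵐ Y) {c : ℝ≥0∞}
    (hc : c ≠ 0) (he : μ.map e = c • ν) (g : Y → ℝ≥0∞) :
    eLpNorm (fun x => g (e x)) p μ = c ^ p⁻¹.toReal * eLpNorm g p ν := by
  have h := e.measurableEmbedding.eLpNorm_map_measure (g := g) (p := p) (μ := μ)
  have h2 : eLpNorm (g ∘ e) p μ = eLpNorm (fun x => g (e x)) p μ := rfl
  rw [← h2, ← h, he, eLpNorm_smul_measure_of_ne_zero hc, smul_eq_mul]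
  simp

end MixedNorms

end

/-! ### Homotheties, power functions and the invariant measure of the cone. -/

noncomputable section

section ComplexLebesgue

variable (E : Type*) [NormedAddCommGroup E] [InnerProductSpace ℂ E]
  [FiniteDimensional ℂ E] [MeasurableSpace E] [BorelSpace E]

instance isAddHaarMeasure_complexLebesgue : (complexLebesgue E).IsAddHaarMeasure := by
  let _ : InnerProductSpace ℝ E := InnerProductSpace.rclikeToReal ℂ E
  have : FiniteDimensional ℝ E := FiniteDimensional.complexToReal E
  unfold complexLebesgue
  infer_instance

instance sigmaFinite_complexLebesgue : SigmaFinite (complexLebesgue E) := by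
  let _ : InnerProductSpace ℝ E := InnerProductSpace.rclikeToReal ℂ E
  have : FiniteDimensional ℝ E := FiniteDimensional.complexToReal E
  unfold complexLebesgue
  infer_instance

end ComplexLebesgue

/-- The homothety of ratio `a > 0`, as a measurable equivalence. -/
def homothetyEquiv (V : Type*) [NormedAddCommGroup V] [NormedSpace ℝ V] [MeasurableSpace V]
    [BorelSpace V] (a : ℝ) (ha : 0 < a) : V ≃ᵐ V :=
  (Homeomorph.smulOfNeZero a ha.ne').toMeasurableEquiv

theorem homothetyEquiv_apply (V : Type*) [NormedAddCommGroup V] [NormedSpace ℝ V]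
    [MeasurableSpace V] [BorelSpace V] (a : ℝ) (ha : 0 < a) (v : V) :
    homothetyEquiv V a ha v = a • v := rfl

theorem map_homothetyEquiv (V : Type*) [NormedAddCommGroup V] [NormedSpace ℝ V]
    [MeasurableSpace V] [BorelSpace V] [FiniteDimensional ℝ V] (μ : Measure V) [μ.IsAddHaarMeasure]
    (a : ℝ) (ha : 0 < a) :
    μ.map (homothetyEquiv V a ha) =
      ENNReal.ofReal (a ^ (-(Module.finrank ℝ V : ℝ))) • μ := by
  have h := Measure.map_addHaar_smul μ ha.ne'
  have e : (homothetyEquiv V a ha : V → V) = fun v => a • v := rfl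
  rw [e, h, Real.rpow_neg ha.le, Real.rpow_natCast, abs_of_nonneg (by positivity)]

namespace SiegelDomain.TriangularGroup.PowerCharacter

variable {E F : Type*} [NormedAddCommGroup E] [InnerProductSpace ℂ E]
  [NormedAddCommGroup F] [InnerProductSpace ℝ F] {S : SiegelDomain E F}
  {G : S.TriangularGroup} {r : ℕ} (P : G.PowerCharacter r)

theorem orbitInv_apply {h : F} (hh : h ∈ S.Ω) :
    ((P.orbitInv h : (F →L[ℝ] F)ˣ) : F →L[ℝ] F) P.e = h := by
  rw [orbitInv, dif_pos hh]
  exact (G.simply_transitive P.e P.e_mem h hh).choose_spec.1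

theorem orbitInv_eq {h : F} (hh : h ∈ S.Ω) {t : G.T}
    (ht : ((t : (F →L[ℝ] F)ˣ) : F →L[ℝ] F) P.e = h) : P.orbitInv h = t :=
  (G.simply_transitive P.e P.e_mem h hh).unique (P.orbitInv_apply hh) ht

theorem power_pos (s : Fin r → ℝ) (h : F) : 0 < P.power s h :=
  Finset.prod_pos fun j _ => Real.rpow_pos_of_pos (P.Δ (P.orbitInv h) j).2 _

theorem power_const_smul (c : ℝ) (s : Fin r → ℝ) (h : F) :
    P.power (c • s) h = P.power s h ^ c := by
  unfold power
  rw [← Real.finsetProd_rpow _ _ fun j _ => Real.rpow_nonneg (P.Δ (P.orbitInv h) j).2.le _]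
  refine Finset.prod_congr rfl fun j _ => ?_
  rw [← Real.rpow_mul (P.Δ (P.orbitInv h) j).2.le, Pi.smul_apply, smul_eq_mul, mul_comm]

/-- Homotheties belong to `T₊`, so by simple transitivity they multiply the group element attached
to `h`, and `Δ` is multiplicative. -/
theorem power_homothety (s : Fin r → ℝ) {a : ℝ} (ha : 0 < a) {h : F} (hh : h ∈ S.Ω) :
    P.power s (a • h) = a ^ (∑ j, s j) * P.power s h := by
  obtain ⟨t, ht, htj⟩ := P.homothety a ha
  have h1 : P.orbitInv (a • h) = t * P.orbitInv h := by
    refine P.orbitInv_eq (S.Ω.smul_mem ha hh) ?_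
    have : (((t * P.orbitInv h : G.T) : (F →L[ℝ] F)ˣ) : F →L[ℝ] F) P.e =
      ((t : (F →L[ℝ] F)ˣ) : F →L[ℝ] F) (((P.orbitInv h : (F →L[ℝ] F)ˣ) : F →L[ℝ] F) P.e) := rfl
    rw [this, P.orbitInv_apply hh, ht]
  unfold power
  rw [h1, Real.rpow_sum_of_pos ha, ← Finset.prod_mul_distrib]
  refine Finset.prod_congr rfl fun j _ => ?_
  rw [map_mul, Pi.mul_apply, Positive.val_mul, htj, Real.mul_rpow ha.le (P.Δ _ j).2.le]

variable [FiniteDimensional ℝ F] [MeasurableSpace F] [BorelSpace F]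

/-- The orbit map `t ↦ t · e_Ω` is a continuous injection of a Polish space, since `T₊` is closed in
the open set of units. By Lusin–Souslin it is a measurable embedding, so no continuity of its
inverse is needed. -/
theorem measurable_power (s : Fin r → ℝ) : Measurable (P.power s) := by
  have : PolishSpace (F →L[ℝ] F)ˣ := by
    have h := (Units.isOpenEmbedding_val (R := F →L[ℝ] F))
    have : PolishSpace (range (Units.val : (F →L[ℝ] F)ˣ → _)) := h.isOpen_range.polishSpace
    exact h.isEmbedding.toHomeomorph.isClosedEmbedding.polishSpace
  have : PolishSpace G.T := G.isClosed_T.polishSpace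
  let _ : MeasurableSpace G.T := borel _
  have : BorelSpace G.T := ⟨rfl⟩
  let φ : G.T → F := fun t => ((t : (F →L[ℝ] F)ˣ) : F →L[ℝ] F) P.e
  have hφ : Continuous φ :=
    (Units.continuous_val.comp continuous_subtype_val).clm_apply continuous_const
  have hinj : Function.Injective φ := fun t t' h =>
    (G.simply_transitive P.e P.e_mem _ (G.mapsTo _ t.2 _ P.e_mem)).unique rfl h.symm
  have hemb := hφ.measurableEmbedding hinj
  have hc : Continuous fun t : G.T => ∏ j, (P.Δ t j : ℝ) ^ s j := by
    refine continuous_finsetProd _ fun j _ => ?_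
    refine Continuous.rpow_const ?_ fun t => Or.inl (P.Δ t j).2.ne'
    exact continuous_subtype_val.comp ((continuous_apply j).comp P.continuous_Δ)
  refine measurable_of_Ioi fun c => ?_
  have key : P.power s ⁻¹' Ioi c = φ '' {t | c < ∏ j, (P.Δ t j : ℝ) ^ s j} ∪
      ((S.Ω : Set F)ᶜ ∩ {_h | c < ∏ j, (P.Δ 1 j : ℝ) ^ s j}) := by
    ext h
    by_cases hh : h ∈ S.Ω
    · constructor
      · intro hc
        exact Or.inl ⟨P.orbitInv h, hc, P.orbitInv_apply hh⟩
      · rintro (⟨t, ht, rfl⟩ | h')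
        · exact ht.trans_eq (P.power_smul s t).symm
        · exact absurd hh h'.1
    · have e : P.power s h = ∏ j, (P.Δ 1 j : ℝ) ^ s j := by
        unfold power
        rw [orbitInv, dif_neg hh]
      constructor
      · intro hc
        exact Or.inr ⟨hh, e ▸ hc⟩
      · rintro (⟨t, ht, rfl⟩ | h')
        · exact absurd (G.mapsTo _ t.2 _ P.e_mem) hh
        · exact h'.2.trans_eq e.symm
  rw [key]
  refine (hemb.measurableSet_image.2 (measurableSet_lt measurable_const hc.measurable)).union ?_
  exact S.isOpen_Ω.measurableSet.compl.inter (MeasurableSet.const _)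

theorem ae_mem_coneMeasure (d : Fin r → ℝ) : ∀ᵐ h ∂P.coneMeasure d, h ∈ S.Ω := by
  refine (withDensity_absolutelyContinuous _ _).ae_le ?_
  exact ae_restrict_mem S.isOpen_Ω.measurableSet

instance sFinite_coneMeasure (d : Fin r → ℝ) : SFinite (P.coneMeasure d) := by
  unfold coneMeasure
  infer_instance

variable [FiniteDimensional ℂ E] [MeasurableSpace E] [BorelSpace E]

theorem map_coneMeasure {d b : Fin r → ℝ} (hdb : P.IsInvariantExponents d b) {a : ℝ} (ha : 0 < a) :
    (P.coneMeasure d).map (homothetyEquiv F a ha) = P.coneMeasure d := by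
  let A : F ≃L[ℝ] F := ContinuousLinearEquiv.smulLeft (Units.mk0 a ha.ne')
  refine hdb.cone A ?_
  ext x
  constructor
  · rintro ⟨y, hy, rfl⟩
    exact S.Ω.smul_mem ha hy
  · intro hx
    refine ⟨a⁻¹ • x, S.Ω.smul_mem (inv_pos.2 ha) hx, ?_⟩
    change a • a⁻¹ • x = x
    rw [smul_inv_smul₀ ha.ne']

/-- The weighted quasi-norm `‖Δ_Ωˢ φ‖_{L^q(ν_Ω)}`. -/
def coneNorm (d : Fin r → ℝ) (q : ℝ≥0∞) (s : Fin r → ℝ) (φ : F → ℝ≥0∞) : ℝ≥0∞ :=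
  eLpNorm (fun h => ENNReal.ofReal (P.power s h) * φ h) q (P.coneMeasure d)

section

variable {d : Fin r → ℝ} {q : ℝ≥0∞} {s : Fin r → ℝ}

theorem coneNorm_mono {φ ψ : F → ℝ≥0∞} (h : ∀ x ∈ S.Ω, φ x ≤ ψ x) :
    P.coneNorm d q s φ ≤ P.coneNorm d q s ψ := by
  refine eLpNorm_ennreal_mono_ae ?_
  filter_upwards [P.ae_mem_coneMeasure d] with x hx
  gcongr
  exact h x hx

theorem coneNorm_congr {φ ψ : F → ℝ≥0∞} (h : ∀ x ∈ S.Ω, φ x = ψ x) :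
    P.coneNorm d q s φ = P.coneNorm d q s ψ :=
  le_antisymm (P.coneNorm_mono fun x hx => (h x hx).le) (P.coneNorm_mono fun x hx => (h x hx).ge)

theorem coneNorm_const_mul (hq : q ≠ 0) {c : ℝ≥0∞} (hc : c ≠ ∞) (φ : F → ℝ≥0∞) :
    P.coneNorm d q s (fun h => c * φ h) = c * P.coneNorm d q s φ := by
  unfold coneNorm
  simp_rw [mul_left_comm _ c]
  exact eLpNorm_ennreal_const_mul hq _ hc _

theorem measurable_coneNorm (hq : q ≠ 0) {X : Type*} [MeasurableSpace X] {g : X → F → ℝ≥0∞}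
    (hg : Measurable (Function.uncurry g)) : Measurable fun x => P.coneNorm d q s (g x) :=
  measurable_eLpNorm_ennreal hq _
    (((P.measurable_power s).ennreal_ofReal.comp measurable_snd).mul hg)

theorem coneNorm_tsum_le (hq : q ≠ 0) {g : ℕ → F → ℝ≥0∞} (hg : ∀ k, Measurable (g k)) :
    P.coneNorm d q s (fun x => ∑' k, g k x) ≤
      tsumConst q * ∑' k, 4 ^ k * P.coneNorm d q s (g k) := by
  unfold coneNorm
  simp_rw [← ENNReal.tsum_mul_left]
  rw [ENNReal.tsum_mul_left]
  exact eLpNorm_ennreal_tsum_le hq _ fun k => (P.measurable_power s).ennreal_ofReal.mul (hg k)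

theorem coneNorm_ne_zero (hq : q ≠ 0) {φ : F → ℝ≥0∞} (hφ : Measurable φ) {A : Set F}
    (hA : IsOpen A) (hA' : (A ∩ S.Ω).Nonempty) (h : ∀ x ∈ S.Ω, x ∈ A → φ x ≠ 0) :
    P.coneNorm d q s φ ≠ 0 := by
  refine eLpNorm_ennreal_ne_zero hq ((P.measurable_power s).ennreal_ofReal.mul hφ)
    (A := A ∩ S.Ω) ?_ ?_
  · intro h0
    have h1 : (volume.restrict (S.Ω : Set F)) ≪ P.coneMeasure d :=
      withDensity_absolutelyContinuous' (P.measurable_power d).ennreal_ofReal.aemeasurable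
        (Filter.Eventually.of_forall fun h => by simpa using P.power_pos d h)
    have h2 := h1 h0
    rw [Measure.restrict_apply (hA.inter S.isOpen_Ω).measurableSet, inter_assoc, inter_self] at h2
    exact ((hA.inter S.isOpen_Ω).measure_pos volume hA').ne' h2
  · intro x hx
    refine mul_ne_zero ?_ (h x hx.2 hx.1)
    simpa using P.power_pos s x

/-- Since `ν_Ω` is invariant under homotheties, only the weight `Δ_Ωˢ` contributes to the scaling
factor, whatever `q` is. -/
theorem coneNorm_homothety {b : Fin r → ℝ} (hdb : P.IsInvariantExponents d b) (hq : q ≠ 0)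
    {a : ℝ} (ha : 0 < a) (φ : F → ℝ≥0∞) :
    P.coneNorm d q s (fun h => φ (a • h)) =
      ENNReal.ofReal (a ^ (-∑ j, s j)) * P.coneNorm d q s φ := by
  have h1 := eLpNorm_ennreal_comp (p := q) (homothetyEquiv F a ha) one_ne_zero
    ((P.map_coneMeasure hdb ha).trans (one_smul _ _).symm)
    (fun h => ENNReal.ofReal (P.power s h) * φ h)
  rw [ENNReal.one_rpow, one_mul] at h1
  unfold coneNorm
  rw [← h1, ← eLpNorm_ennreal_const_mul hq _ ENNReal.ofReal_ne_top]
  refine eLpNorm_congr_ae ?_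
  filter_upwards [P.ae_mem_coneMeasure d] with x hx
  rw [homothetyEquiv_apply, P.power_homothety s ha hx, ENNReal.ofReal_mul (by positivity),
    ← mul_assoc, ← mul_assoc, ← ENNReal.ofReal_mul (by positivity), ← Real.rpow_add ha,
    neg_add_cancel, Real.rpow_zero, ENNReal.ofReal_one, one_mul]

end

end SiegelDomain.TriangularGroup.PowerCharacter

end

/-! ### Weighted integrability on the cone, near the origin and at infinity. -/

noncomputable section

/-- The weight `(1 + ‖v‖)^(-K)`. -/
def decay {V : Type*} [NormedAddCommGroup V] (K : ℝ) (v : V) : ℝ≥0∞ :=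
  ENNReal.ofReal ((1 + ‖v‖) ^ (-K))

theorem measurable_decay {V : Type*} [NormedAddCommGroup V] [MeasurableSpace V] [BorelSpace V]
    (K : ℝ) : Measurable (decay K : V → ℝ≥0∞) :=
  ((measurable_norm.const_add 1).pow_const _).ennreal_ofReal

theorem decay_anti {V : Type*} [NormedAddCommGroup V] {K K' : ℝ} (h : K ≤ K') (v : V) :
    decay K' v ≤ decay K v := by
  refine ENNReal.ofReal_le_ofReal (Real.rpow_le_rpow_of_exponent_le ?_ (by linarith))
  linarith [norm_nonneg v]

theorem decay_le_one {V : Type*} [NormedAddCommGroup V] {K : ℝ} (h : 0 ≤ K) (v : V) :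
    decay K v ≤ 1 := by
  refine (decay_anti h v).trans ?_
  simp [decay]

theorem exists_eLpNorm_decay_lt_top {V : Type*} [NormedAddCommGroup V] [NormedSpace ℝ V]
    [FiniteDimensional ℝ V] [MeasurableSpace V] [BorelSpace V] (μ : Measure V) [μ.IsAddHaarMeasure]
    {p : ℝ≥0∞} (hp : p ≠ 0) : ∃ K₀ : ℝ, ∀ K, K₀ ≤ K → eLpNorm (decay K : V → ℝ≥0∞) p μ < ∞ := by
  by_cases hp' : p = ∞
  · subst hp'
    refine ⟨0, fun K hK => ?_⟩
    rw [eLpNorm_ennreal_top]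
    exact (essSup_le_of_ae_le 1 (Filter.Eventually.of_forall fun v => decay_le_one hK v)).trans_lt
      (by simp)
  · have h0 : 0 < p.toReal := ENNReal.toReal_pos hp hp'
    refine ⟨(Module.finrank ℝ V + 1) / p.toReal, fun K hK => ?_⟩
    rw [eLpNorm_ennreal_of_ne_top hp hp']
    refine ENNReal.rpow_lt_top_of_nonneg (by positivity) (ne_of_lt ?_)
    have h1 : (Module.finrank ℝ V : ℝ) < K * p.toReal := by
      rw [div_le_iff₀ h0] at hK
      linarith
    refine lt_of_eq_of_lt ?_ (finite_integral_one_add_norm (μ := μ) h1)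
    refine lintegral_congr fun v => ?_
    have : 0 < 1 + ‖v‖ := by positivity
    unfold decay
    rw [ENNReal.ofReal_rpow_of_nonneg (by positivity) h0.le, ← Real.rpow_mul this.le, neg_mul]

namespace SiegelDomain.TriangularGroup.PowerCharacter

variable {E F : Type*} [NormedAddCommGroup E] [InnerProductSpace ℂ E]
  [NormedAddCommGroup F] [InnerProductSpace ℝ F] {S : SiegelDomain E F}
  {G : S.TriangularGroup} {r : ℕ} (P : G.PowerCharacter r)
  [FiniteDimensional ℝ F] [MeasurableSpace F] [BorelSpace F]
  [FiniteDimensional ℂ E] [MeasurableSpace E] [BorelSpace E]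
  {d b m : Fin r → ℝ} {q : ℝ≥0∞} {s : Fin r → ℝ}

/-- The characteristic function of the closed unit ball. -/
def unitBall (h : F) : ℝ≥0∞ := (Metric.closedBall (0 : F) 1).indicator 1 h

theorem measurable_unitBall : Measurable (unitBall : F → ℝ≥0∞) :=
  measurable_one.indicator Metric.isClosed_closedBall.measurableSet

/-- This is where the assumption on `s` enters. For `q < ∞` it says that `Δ_Ω^{qs} · ν_Ω` is Radon;
for `q = ∞` it says that `Δ_Ωˢ` is bounded on bounded sets. -/
theorem coneNorm_unitBall_lt_top (hm : P.IsRadonExponent d m) (hq : q ≠ 0)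
    (hs : (∀ j, (2 * q)⁻¹.toReal * m j < s j) ∨ (q = ∞ ∧ ∀ j, 0 ≤ s j)) :
    P.coneNorm d q s unitBall < ∞ := by
  by_cases hq' : q = ∞
  · subst hq'
    have hs' : ∀ j, 0 ≤ s j := by
      rcases hs with hs | hs
      · intro j
        -- At `q = ∞` the coefficient of `m j` is `0`, so the first alternative reads `0 < s j`.
        simpa using (hs j).le
      · exact hs.2
    obtain ⟨C, hC⟩ := (P.bounded_iff s).2 hs' (Metric.closedBall 0 1 ∩ S.Ω) inter_subset_right
      (Metric.isBounded_closedBall.subset inter_subset_left)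
    unfold coneNorm
    rw [eLpNorm_ennreal_top]
    refine (essSup_le_of_ae_le (ENNReal.ofReal C) ?_).trans_lt ENNReal.ofReal_lt_top
    filter_upwards [P.ae_mem_coneMeasure d] with x hx
    unfold unitBall
    by_cases hx' : x ∈ Metric.closedBall (0 : F) 1
    · rw [indicator_of_mem hx', Pi.one_apply, mul_one]
      refine ENNReal.ofReal_le_ofReal ?_
      exact hC (P.orbitInv x) (by rw [P.orbitInv_apply hx]; exact ⟨hx', hx⟩)
    · rw [indicator_of_notMem hx', mul_zero]
      exact zero_le
  · have h0 : 0 < q.toReal := ENNReal.toReal_pos hq hq'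
    have hs' : ∀ j, m j / 2 < (q.toReal • s) j := by
      intro j
      have := (hs.resolve_right fun h => hq' h.1) j
      rw [ENNReal.toReal_inv, ENNReal.toReal_mul, ENNReal.toReal_ofNat, mul_inv] at this
      have h2 := mul_lt_mul_of_pos_left this h0
      rw [Pi.smul_apply, smul_eq_mul]
      refine lt_of_eq_of_lt ?_ h2
      field_simp
    have hloc := (hm (q.toReal • s)).2 hs'
    have hB := (isCompact_closedBall (0 : F) 1).measure_lt_top
      (μ := (P.coneMeasure d).withDensity fun h => ENNReal.ofReal (P.power (q.toReal • s) h))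
    rw [withDensity_apply _ Metric.isClosed_closedBall.measurableSet,
      ← lintegral_indicator Metric.isClosed_closedBall.measurableSet] at hB
    unfold coneNorm
    rw [eLpNorm_ennreal_of_ne_top hq hq']
    refine ENNReal.rpow_lt_top_of_nonneg (by positivity) (ne_of_lt (lt_of_eq_of_lt ?_ hB))
    refine lintegral_congr fun x => ?_
    unfold unitBall
    by_cases hx' : x ∈ Metric.closedBall (0 : F) 1
    · rw [indicator_of_mem hx', indicator_of_mem hx', Pi.one_apply, mul_one, P.power_const_smul,
        ENNReal.ofReal_rpow_of_pos (P.power_pos s x)]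
    · rw [indicator_of_notMem hx', indicator_of_notMem hx', mul_zero, ENNReal.zero_rpow_of_pos h0]

theorem coneNorm_unitBall_ne_zero (hq : q ≠ 0) : P.coneNorm d q s unitBall ≠ 0 := by
  refine P.coneNorm_ne_zero hq measurable_unitBall (A := Metric.ball 0 1) Metric.isOpen_ball ?_ ?_
  · obtain ⟨x, hx⟩ := S.nonempty_Ω
    refine ⟨(1 + ‖x‖)⁻¹ • x, ?_, S.Ω.smul_mem (by positivity) hx⟩
    rw [mem_ball_zero_iff, norm_smul, Real.norm_of_nonneg (by positivity),
      inv_mul_lt_one₀ (by positivity)]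
    linarith
  · intro x _ hx
    unfold unitBall
    rw [indicator_of_mem (Metric.ball_subset_closedBall hx)]
    simp

/-- Halving the ball cannot increase its norm, yet it multiplies this finite nonzero quantity by `2
^ (-∑ s)`. The conclusion makes the homogeneity degrees nonnegative. -/
theorem sum_exponent_nonneg (hdb : P.IsInvariantExponents d b) (hq : q ≠ 0)
    (hfin : P.coneNorm d q s unitBall < ∞) : 0 ≤ ∑ j, s j := by
  have h0 := P.coneNorm_unitBall_ne_zero (d := d) (s := s) hq
  have h1 := P.coneNorm_homothety (d := d) (s := s) hdb hq (a := 2) two_pos unitBall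
  have h2 : P.coneNorm d q s (fun h => unitBall ((2 : ℝ) • h)) ≤ P.coneNorm d q s unitBall := by
    refine P.coneNorm_mono fun x _ => ?_
    unfold unitBall
    by_cases hx : (2 : ℝ) • x ∈ Metric.closedBall (0 : F) 1
    · have hx' : x ∈ Metric.closedBall (0 : F) 1 := by
        rw [mem_closedBall_zero_iff, norm_smul] at hx
        rw [mem_closedBall_zero_iff]
        norm_num at hx
        linarith [norm_nonneg x]
      rw [indicator_of_mem hx, indicator_of_mem hx']
      rfl
    · rw [indicator_of_notMem hx]
      exact zero_le
  rw [h1] at h2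
  by_contra! hlt
  have h3 : (1 : ℝ≥0∞) < ENNReal.ofReal (2 ^ (-∑ j, s j)) := by
    rw [ENNReal.one_lt_ofReal]
    exact Real.one_lt_rpow (by norm_num) (by linarith)
  have h4 := ENNReal.mul_lt_mul_left h0 hfin.ne h3
  rw [one_mul] at h4
  exact absurd h2 (not_le.2 h4)

/-- Only the term of the least `k` with `‖h‖ ≤ 2 ^ k` is kept. Minimality gives `2 ^ (k - 1) < ‖h‖`
when `k > 0`, whence the constant `2 ^ K`. -/
theorem decay_le_tsum_unitBall (K : ℕ) (h : F) :
    decay (K : ℝ) h ≤ ∑' k : ℕ, ENNReal.ofReal (2 ^ K * (2⁻¹ ^ k) ^ K) *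
      unitBall ((2⁻¹ : ℝ) ^ k • h) := by
  classical
  have hex : ∃ k : ℕ, ‖h‖ ≤ 2 ^ k := by
    obtain ⟨k, hk⟩ := pow_unbounded_of_one_lt ‖h‖ (one_lt_two)
    exact ⟨k, hk.le⟩
  let k := Nat.find hex
  have hk : ‖h‖ ≤ 2 ^ k := Nat.find_spec hex
  refine le_trans ?_ (ENNReal.le_tsum k)
  have hb : unitBall ((2⁻¹ : ℝ) ^ k • h) = 1 := by
    unfold unitBall
    rw [indicator_of_mem]
    · rfl
    · rw [mem_closedBall_zero_iff, norm_smul, Real.norm_of_nonneg (by positivity), inv_pow,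
        inv_mul_le_one₀ (by positivity)]
      exact hk
  rw [hb, mul_one]
  refine ENNReal.ofReal_le_ofReal ?_
  rw [Real.rpow_neg (by positivity), Real.rpow_natCast, ← mul_pow, ← inv_pow]
  refine pow_le_pow_left₀ (by positivity) ?_ _
  rcases Nat.eq_zero_or_pos k with h0 | h0
  · rw [h0, pow_zero, mul_one]
    have : (1 + ‖h‖)⁻¹ ≤ 1 := inv_le_one_of_one_le₀ (by linarith [norm_nonneg h])
    linarith
  · have h1 := Nat.find_min hex (m := k - 1) (Nat.sub_lt h0 one_pos)
    rw [not_le] at h1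
    rw [inv_pow, ← div_eq_mul_inv, ← inv_div]
    refine inv_anti₀ (by positivity) ?_
    have h2 : (2 : ℝ) ^ k / 2 = 2 ^ (k - 1) := by
      rw [div_eq_iff two_ne_zero, ← pow_succ, Nat.sub_add_cancel h0]
    rw [h2]
    linarith

theorem exists_coneNorm_decay_lt_top (hdb : P.IsInvariantExponents d b) (hq : q ≠ 0)
    (hfin : P.coneNorm d q s unitBall < ∞) :
    ∃ K₀ : ℝ, ∀ K, K₀ ≤ K → P.coneNorm d q s (decay K) < ∞ := by
  -- With `σ = ∑ s`, the `k`-th dyadic term has size `4 ^ k` from the quasi-triangle inequality,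
  -- times `2 ^ (kσ)` from the dilation, times `2 ^ (-kK)`. For `K ≥ σ + 3` this is at most `2 ^
  -- (-k)`.
  obtain ⟨K, hK⟩ := exists_nat_gt (∑ j, s j + 3)
  refine ⟨K, fun K' hK' => (P.coneNorm_mono fun h _ => decay_anti hK' h).trans_lt ?_⟩
  refine (P.coneNorm_mono fun h _ => decay_le_tsum_unitBall K h).trans_lt ?_
  refine (P.coneNorm_tsum_le hq fun k => ?_).trans_lt ?_
  · exact (measurable_unitBall.comp (measurable_const_smul _)).const_mul _
  refine ENNReal.mul_lt_top (tsumConst_ne_top hq).lt_top ?_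
  have hterm : ∀ k : ℕ, 4 ^ k * P.coneNorm d q s (fun h => ENNReal.ofReal (2 ^ K * (2⁻¹ ^ k) ^ K) *
      unitBall ((2⁻¹ : ℝ) ^ k • h)) ≤ 2⁻¹ ^ k * (2 ^ K * P.coneNorm d q s unitBall) := by
    intro k
    rw [P.coneNorm_const_mul hq ENNReal.ofReal_ne_top,
      P.coneNorm_homothety hdb hq (a := 2⁻¹ ^ k) (by positivity), ← mul_assoc, ← mul_assoc,
      ← mul_assoc]
    refine mul_le_mul_left ?_ _
    have e1 : (4 : ℝ≥0∞) ^ k = ENNReal.ofReal (4 ^ k) := by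
      rw [ENNReal.ofReal_pow (by norm_num)]; norm_num
    have e2 : (2⁻¹ : ℝ≥0∞) ^ k * 2 ^ K = ENNReal.ofReal (2⁻¹ ^ k * 2 ^ K) := by
      rw [ENNReal.ofReal_mul (by positivity), ENNReal.ofReal_pow (by norm_num),
        ENNReal.ofReal_pow (by norm_num), ENNReal.ofReal_inv_of_pos two_pos]
      norm_num
    rw [e1, e2, ← ENNReal.ofReal_mul (by positivity), ← ENNReal.ofReal_mul (by positivity)]
    refine ENNReal.ofReal_le_ofReal ?_
    set σ := ∑ j, s j
    have h2 : ((2⁻¹ : ℝ) ^ k) ^ (-σ) ≤ ((2⁻¹ : ℝ) ^ k) ^ (3 - K : ℝ) := by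
      refine Real.rpow_le_rpow_of_exponent_ge (by positivity)
        (pow_le_one₀ (by norm_num) (by norm_num)) (by linarith)
    have h3 : ((2⁻¹ : ℝ) ^ k) ^ K * ((2⁻¹ : ℝ) ^ k) ^ (3 - K : ℝ) = ((2⁻¹ : ℝ) ^ k) ^ 3 := by
      rw [← Real.rpow_natCast _ K, ← Real.rpow_add (by positivity), ← Real.rpow_natCast _ 3]
      congr 1
      push_cast
      ring
    calc (4 : ℝ) ^ k * (2 ^ K * (2⁻¹ ^ k) ^ K) * (2⁻¹ ^ k) ^ (-σ)
        ≤ (4 : ℝ) ^ k * (2 ^ K * (2⁻¹ ^ k) ^ K) * (2⁻¹ ^ k) ^ (3 - K : ℝ) := by gcongr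
      _ = (4 : ℝ) ^ k * 2 ^ K * ((2⁻¹ : ℝ) ^ k) ^ 3 := by rw [← h3]; ring
      _ = 2⁻¹ ^ k * 2 ^ K := by
        have : (4 : ℝ) ^ k * (2⁻¹ ^ k) ^ 2 = 1 := by
          rw [← pow_mul, mul_comm k, pow_mul, ← mul_pow]; norm_num
        linear_combination (2⁻¹ ^ k * 2 ^ K) * this
  refine (ENNReal.tsum_le_tsum hterm).trans_lt ?_
  rw [ENNReal.tsum_mul_right, ENNReal.tsum_geometric_two]
  exact ENNReal.mul_lt_top (by simp) (ENNReal.mul_lt_top (by simp) hfin)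

end SiegelDomain.TriangularGroup.PowerCharacter

end

/-! ### The coordinates `(ζ, x, h)`, the two quasi-norms and the interchange of integrations. -/

noncomputable section

namespace Complexification

variable {F : Type*} [NormedAddCommGroup F] [InnerProductSpace ℝ F]

theorem continuous_re : Continuous (re : Complexification F → F) :=
  WithLp.prod_continuous_ofLp 2 F F |>.fst

theorem continuous_im : Continuous (im : Complexification F → F) :=
  WithLp.prod_continuous_ofLp 2 F F |>.snd

theorem continuous_ofReIm : Continuous fun w : F × F => Complexification.ofReIm w.1 w.2 :=
  WithLp.prod_continuous_toLp 2 F F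

end Complexification

namespace SiegelDomain

variable {E F : Type*} [NormedAddCommGroup E] [InnerProductSpace ℂ E]
  [NormedAddCommGroup F] [InnerProductSpace ℝ F] (S : SiegelDomain E F)

/-- `Φ` is only given as a sesquilinear map; continuity comes from expanding in a finite basis of
`E`. -/
theorem continuous_quad [FiniteDimensional ℂ E] : Continuous S.quad := by
  let β := Module.finBasis ℂ E
  have h : ∀ ζ, S.Φ ζ ζ = ∑ i, ∑ j, (β.repr ζ i * starRingEnd ℂ (β.repr ζ j)) • S.Φ (β i) (β j) := by
    intro ζ
    conv_lhs => rw [← β.sum_repr ζ]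
    simp only [map_sum, LinearMap.sum_apply, map_smul, LinearMap.smul_apply, map_smulₛₗ,
      Finset.smul_sum, smul_smul]
    rw [Finset.sum_comm]
    simp only [mul_comm]
  have hc : ∀ i, Continuous fun ζ => β.repr ζ i := fun i =>
    (β.coord i).continuous_of_finiteDimensional
  have : Continuous fun ζ => S.Φ ζ ζ := by
    simp_rw [h]
    refine continuous_finsetSum _ fun i _ => continuous_finsetSum _ fun j _ => ?_
    exact ((hc i).mul (Complex.continuous_conj.comp (hc j))).smul continuous_const
  exact Complexification.continuous_re.comp this

/-- The absolute value of a function on `D` in the coordinates `(ζ, x, h)` with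
`z = x + i(Φ(ζ) + h)`, extended by `0` to `h ∉ Ω`. -/
def coord (f : E × Complexification F → ℂ) (ζ : E) (x h : F) : ℝ≥0∞ :=
  (S.Ω : Set F).indicator (fun h => ‖f (ζ, Complexification.ofReIm x (S.quad ζ + h))‖ₑ) h

theorem coord_of_mem (f : E × Complexification F → ℂ) (ζ : E) (x : F) {h : F} (hh : h ∈ S.Ω) :
    S.coord f ζ x h = ‖f (ζ, Complexification.ofReIm x (S.quad ζ + h))‖ₑ :=
  indicator_of_mem hh _

theorem mem_domain_coord (ζ : E) (x : F) {h : F} (hh : h ∈ S.Ω) :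
    (ζ, Complexification.ofReIm x (S.quad ζ + h)) ∈ S.domain := by
  have : S.rho (ζ, Complexification.ofReIm x (S.quad ζ + h)) = h := by simp [rho]
  unfold domain
  rw [mem_ofPred_eq, this]
  exact hh

theorem measurable_coord [FiniteDimensional ℂ E] [MeasurableSpace E] [BorelSpace E]
    [FiniteDimensional ℝ F] [MeasurableSpace F] [BorelSpace F] {f : E × Complexification F → ℂ}
    (hf : ContinuousOn f S.domain) :
    Measurable fun w : E × F × F => S.coord f w.1 w.2.1 w.2.2 := by
  have : ProperSpace E := FiniteDimensional.proper ℂ E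
  let κ : E × F × F → E × Complexification F :=
    fun w => (w.1, Complexification.ofReIm w.2.1 (S.quad w.1 + w.2.2))
  have hκ : Continuous κ := by
    refine continuous_fst.prodMk (Complexification.continuous_ofReIm.comp
      (f := fun w : E × F × F => (w.2.1, S.quad w.1 + w.2.2)) (continuous_snd.fst.prodMk ?_))
    exact (S.continuous_quad.comp continuous_fst).add continuous_snd.snd
  have hU : IsOpen {w : E × F × F | w.2.2 ∈ S.Ω} := S.isOpen_Ω.preimage continuous_snd.snd
  have hc : ContinuousOn (fun w => ‖f (κ w)‖ₑ) {w : E × F × F | w.2.2 ∈ S.Ω} :=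
    (hf.comp hκ.continuousOn fun w hw => S.mem_domain_coord w.1 w.2.1 hw).enorm
  classical
  have := hc.measurable_piecewise (continuousOn_const (c := (0 : ℝ≥0∞))) hU.measurableSet
  convert this using 1
  ext w
  by_cases hw : w.2.2 ∈ S.Ω
  · rw [S.coord_of_mem f _ _ hw, piecewise_eq_of_mem _ _ _ (by exact hw)]
  · rw [piecewise_eq_of_notMem _ _ _ (by exact hw)]
    exact indicator_of_notMem (by exact hw) _

end SiegelDomain

namespace SiegelDomain.TriangularGroup.PowerCharacter

variable {E F : Type*} [NormedAddCommGroup E] [InnerProductSpace ℂ E]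
  [NormedAddCommGroup F] [InnerProductSpace ℝ F] {S : SiegelDomain E F}
  {G : S.TriangularGroup} {r : ℕ} (P : G.PowerCharacter r)
  [FiniteDimensional ℂ E] [MeasurableSpace E] [BorelSpace E]
  [FiniteDimensional ℝ F] [MeasurableSpace F] [BorelSpace F]

/-- The quasi-norm of `A^{p,q}_s(D)`, for functions of the coordinates `(ζ, x, h)`. -/
def normA (d : Fin r → ℝ) (p q : ℝ≥0∞) (s : Fin r → ℝ) (K : E → F → F → ℝ≥0∞) : ℝ≥0∞ :=
  P.coneNorm d q s fun h =>
    eLpNorm (fun n : E × F => K n.1 n.2 h) p ((complexLebesgue E).prod volume)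

/-- The quasi-norm of `𝒜^{p,q}_s(D)`, for functions of the coordinates `(ζ, x, h)`. -/
def normB (d : Fin r → ℝ) (p q : ℝ≥0∞) (s : Fin r → ℝ) (K : E → F → F → ℝ≥0∞) : ℝ≥0∞ :=
  eLpNorm (fun ζ => P.coneNorm d q s fun h => eLpNorm (K ζ · h) p volume) q (complexLebesgue E)

variable {d b : Fin r → ℝ} {p q : ℝ≥0∞} {s : Fin r → ℝ}

theorem bergmanNorm_eq (f : E × Complexification F → ℂ) :
    P.bergmanNorm d p q s f = P.normA d p q s (S.coord f) := by
  refine P.coneNorm_congr fun h hh => ?_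
  rw [← eLpNorm_enorm]
  congr 1
  ext n
  rw [S.coord_of_mem f _ _ hh]
  rfl

theorem tubeNorm_tubeSlice_eq (f : E × Complexification F → ℂ) (ζ : E) :
    P.tubeNorm d p q s (S.tubeSlice f ζ) =
      P.coneNorm d q s fun h => eLpNorm (S.coord f ζ · h) p volume := by
  refine P.coneNorm_congr fun h hh => ?_
  rw [← eLpNorm_enorm]
  congr 1
  ext x
  rw [S.coord_of_mem f _ _ hh]
  unfold tubeSlice
  congr 3
  ext <;> simp [add_comm]

theorem bergmanCal_norm_eq (f : E × Complexification F → ℂ) :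
    eLpNorm (fun ζ : E => P.tubeNorm d p q s (S.tubeSlice f ζ)) q (complexLebesgue E) =
      P.normB d p q s (S.coord f) := by
  simp_rw [tubeNorm_tubeSlice_eq]
  rfl

section

variable {K : E → F → F → ℝ≥0∞} (hK : Measurable fun w : E × F × F => K w.1 w.2.1 w.2.2)
include hK

theorem measurable_eLpNorm_fibre (hp : p ≠ 0) :
    Measurable fun w : E × F => eLpNorm (K w.1 · w.2) p volume := by
  refine measurable_eLpNorm_ennreal (g := fun (w : E × F) x => K w.1 x w.2) hp _ ?_
  exact hK.comp (measurable_fst.fst.prodMk (measurable_snd.prodMk measurable_fst.snd))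

theorem measurable_eLpNorm_slice (hp : p ≠ 0) :
    Measurable fun h : F => eLpNorm (fun n : E × F => K n.1 n.2 h) p
      ((complexLebesgue E).prod volume) := by
  refine measurable_eLpNorm_ennreal (g := fun h (n : E × F) => K n.1 n.2 h) hp _ ?_
  exact hK.comp (measurable_snd.fst.prodMk (measurable_snd.snd.prodMk measurable_fst))

/-- The norms over `E` and over the cone have the same exponent `q`, so Tonelli applies, also for `q
= ∞`. Both descriptions in part (1) and the case `p = q` of part (2) rest on this. -/
theorem normB_eq_swap (hp : p ≠ 0) (hq : q ≠ 0) :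
    P.normB d p q s K = P.coneNorm d q s fun h =>
      eLpNorm (fun ζ => eLpNorm (K ζ · h) p volume) q (complexLebesgue E) := by
  unfold normB coneNorm
  rw [eLpNorm_ennreal_swap hq]
  · congr 1
    ext h
    rw [eLpNorm_ennreal_const_mul hq _ ENNReal.ofReal_ne_top]
  · exact ((P.measurable_power s).ennreal_ofReal.comp measurable_snd).mul
      (measurable_eLpNorm_fibre hK hp)

theorem eLpNorm_slice_eq (hp : p ≠ 0) (h : F) :
    eLpNorm (fun n : E × F => K n.1 n.2 h) p ((complexLebesgue E).prod volume) =
      eLpNorm (fun ζ => eLpNorm (K ζ · h) p volume) p (complexLebesgue E) := by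
  refine eLpNorm_ennreal_prod hp _ _ (g := fun n : E × F => K n.1 n.2 h) ?_
  exact hK.comp (measurable_fst.prodMk (measurable_snd.prodMk measurable_const))

theorem normA_eq_normB (hp : p ≠ 0) : P.normA d p p s K = P.normB d p p s K := by
  rw [P.normB_eq_swap hK hp hp]
  unfold normA
  simp_rw [eLpNorm_slice_eq hK hp]

/-- `E` is a point of finite positive mass, so both norms are finite nonzero multiples of the same
norm `X` over `F` and the cone. -/
theorem normA_lt_top_iff_of_subsingleton [Subsingleton E] (hp : p ≠ 0) (hq : q ≠ 0) :
    P.normA d p q s K < ∞ ↔ P.normB d p q s K < ∞ := by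
  set X := P.coneNorm d q s fun h => eLpNorm (K 0 · h) p volume with hX
  have hμ : complexLebesgue E ≠ 0 := NeZero.ne _
  have hμ' : complexLebesgue E univ ≠ 0 := by simpa using hμ
  have hμ'' : complexLebesgue E univ ≠ ∞ :=
    (subsingleton_univ.isCompact.measure_lt_top).ne
  have hc : ∀ t : ℝ≥0∞, (complexLebesgue E univ) ^ (1 / t.toReal) ≠ ∞ := fun t =>
    ENNReal.rpow_ne_top_of_nonneg (by positivity) hμ''
  have hc' : ∀ t : ℝ≥0∞, (complexLebesgue E univ) ^ (1 / t.toReal) ≠ 0 := fun t =>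
    (ENNReal.rpow_pos (pos_iff_ne_zero.2 hμ') hμ'').ne'
  have hB : P.normB d p q s K = X * (complexLebesgue E univ) ^ (1 / q.toReal) := by
    unfold normB
    have : (fun ζ => P.coneNorm d q s fun h => eLpNorm (K ζ · h) p volume) = fun _ => X := by
      ext ζ
      rw [Subsingleton.elim ζ 0]
    rw [this, eLpNorm_const _ hq hμ, enorm_eq_self]
  have hA : P.normA d p q s K = (complexLebesgue E univ) ^ (1 / p.toReal) * X := by
    have : ∀ h, eLpNorm (fun n : E × F => K n.1 n.2 h) p ((complexLebesgue E).prod volume) =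
        (complexLebesgue E univ) ^ (1 / p.toReal) * eLpNorm (K 0 · h) p volume := by
      intro h
      have h0 : (fun ζ => eLpNorm (K ζ · h) p volume) = fun _ => eLpNorm (K 0 · h) p volume := by
        ext ζ
        rw [Subsingleton.elim ζ 0]
      rw [eLpNorm_slice_eq hK hp, h0, eLpNorm_const _ hp hμ, enorm_eq_self, mul_comm]
    unfold normA
    simp_rw [this]
    rw [P.coneNorm_const_mul hq (hc p)]
  rw [hA, hB, mul_comm]
  simp only [lt_top_iff_ne_top, ne_eq, ENNReal.mul_eq_top, hc, hc', not_false_eq_true, and_true,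
    and_false, false_or]

end

theorem bergmanFrakWeighted_norm_eq (hp : p ≠ 0) (hq : q ≠ 0) {f : E × Complexification F → ℂ}
    (hf : ContinuousOn f S.domain) :
    eLpNorm (fun h : F => mixedNorm p q (S.slice f h)) q
      ((P.coneMeasure d).withDensity fun h => ENNReal.ofReal (P.power s h)) =
    P.normB d p q (q⁻¹.toReal • s) (S.coord f) := by
  have hK := S.measurable_coord hf
  rw [P.normB_eq_swap hK hp hq]
  have hmeas : Measurable fun h : F =>
      eLpNorm (fun ζ => eLpNorm (S.coord f ζ · h) p volume) q (complexLebesgue E) := by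
    have h0 := (measurable_eLpNorm_fibre hK hp).comp measurable_swap
    exact measurable_eLpNorm_ennreal (g := fun h ζ => eLpNorm (S.coord f ζ · h) p volume) hq _ h0
  have h1 : (fun h : F => mixedNorm p q (S.slice f h)) =ᵐ[(P.coneMeasure d).withDensity fun h =>
      ENNReal.ofReal (P.power s h)] fun h =>
      eLpNorm (fun ζ => eLpNorm (S.coord f ζ · h) p volume) q (complexLebesgue E) := by
    filter_upwards [(withDensity_absolutelyContinuous _ _).ae_le (P.ae_mem_coneMeasure d)] with h hh
    unfold mixedNorm
    congr 1
    ext ζ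
    rw [← eLpNorm_enorm]
    congr 1
    ext x
    rw [S.coord_of_mem f _ _ hh]
    rfl
  rw [eLpNorm_congr_ae h1, eLpNorm_ennreal_withDensity hq _ (P.measurable_power s).ennreal_ofReal
    hmeas fun h => by simpa using P.power_pos s h]
  unfold coneNorm
  congr 1
  ext h
  rw [P.power_const_smul, ENNReal.ofReal_rpow_of_pos (P.power_pos s h)]

end SiegelDomain.TriangularGroup.PowerCharacter

end

/-! ### Both quasi-norms are homogeneous under the dilations of the domain. -/

noncomputable section

namespace SiegelDomain

variable {E F : Type*} [NormedAddCommGroup E] [InnerProductSpace ℂ E]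
  [NormedAddCommGroup F] [InnerProductSpace ℝ F]

/-- A quasi-norm on the functions of the coordinates `(ζ, x, h)`, `h ∈ Ω`, which is homogeneous of
degree `-α` under the dilations `(ζ, x, h) ↦ (a^{1/2} ζ, a x, a h)`. -/
structure IsDilationNorm (S : SiegelDomain E F) [MeasurableSpace E] [MeasurableSpace F]
    (N : (E → F → F → ℝ≥0∞) → ℝ≥0∞) (α : ℝ) : Prop where
  mono : ∀ K K' : E → F → F → ℝ≥0∞, (∀ ζ x, ∀ h ∈ S.Ω, K ζ x h ≤ K' ζ x h) → N K ≤ N K'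
  const_mul : ∀ c : ℝ≥0∞, c ≠ ∞ → ∀ K, N (fun ζ x h => c * K ζ x h) = c * N K
  dilate : ∀ a : ℝ, 0 < a → ∀ K : E → F → F → ℝ≥0∞,
    N (fun ζ x h => K (√a • ζ) (a • x) (a • h)) = ENNReal.ofReal (a ^ (-α)) * N K
  -- `64 = 4 ^ 3`: each nested quasi-norm costs a factor `4 ^ k`, and `𝒜` has three of them.
  tsum_le : ∃ C : ℝ≥0∞, C ≠ ∞ ∧ ∀ K : ℕ → E → F → F → ℝ≥0∞,
    (∀ k, Measurable fun w : E × F × F => K k w.1 w.2.1 w.2.2) →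
    N (fun ζ x h => ∑' k, K k ζ x h) ≤ C * ∑' k, 64 ^ k * N (K k)
  finite : ∃ L₀ : ℝ, ∀ L, L₀ ≤ L → N (fun ζ x h => decay L ζ * decay L x * decay L h) < ∞
  -- The form is adapted to functions cut off to an open sector around `x = 0`: their nonvanishing
  -- set has open nonempty slices, hence slices of positive measure.
  ne_zero : ∀ K : E → F → F → ℝ≥0∞, (Measurable fun w : E × F × F => K w.1 w.2.1 w.2.2) →
    (∀ h ∈ S.Ω, IsOpen {n : E × F | K n.1 n.2 h ≠ 0}) → (∀ ζ, ∀ h ∈ S.Ω, K ζ 0 h ≠ 0) → N K ≠ 0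

namespace TriangularGroup.PowerCharacter

variable {S : SiegelDomain E F} {G : S.TriangularGroup} {r : ℕ} (P : G.PowerCharacter r)
  [FiniteDimensional ℂ E] [MeasurableSpace E] [BorelSpace E]
  [FiniteDimensional ℝ F] [MeasurableSpace F] [BorelSpace F]
  {d b : Fin r → ℝ} {p q : ℝ≥0∞} {s : Fin r → ℝ}

theorem eLpNorm_homothety {V : Type*} [NormedAddCommGroup V] [NormedSpace ℝ V] [MeasurableSpace V]
    [BorelSpace V] [FiniteDimensional ℝ V] (μ : Measure V) [μ.IsAddHaarMeasure] (p : ℝ≥0∞) {a : ℝ}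
    (ha : 0 < a) (g : V → ℝ≥0∞) :
    eLpNorm (fun v => g (a • v)) p μ =
      ENNReal.ofReal (a ^ (-(Module.finrank ℝ V * p⁻¹.toReal))) * eLpNorm g p μ := by
  have h := eLpNorm_ennreal_comp (p := p) (homothetyEquiv V a ha)
    (c := ENNReal.ofReal (a ^ (-(Module.finrank ℝ V : ℝ))))
    (ENNReal.ofReal_pos.2 (Real.rpow_pos_of_pos ha _)).ne' (map_homothetyEquiv V μ a ha) g
  rw [ENNReal.ofReal_rpow_of_pos (Real.rpow_pos_of_pos ha _), ← Real.rpow_mul ha.le, neg_mul] at h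
  exact h

theorem eLpNorm_homothety_prod {V W : Type*} [NormedAddCommGroup V] [NormedSpace ℝ V]
    [MeasurableSpace V] [BorelSpace V] [FiniteDimensional ℝ V] [NormedAddCommGroup W]
    [NormedSpace ℝ W] [MeasurableSpace W] [BorelSpace W] [FiniteDimensional ℝ W] (μ : Measure V)
    [μ.IsAddHaarMeasure] (ν : Measure W) [ν.IsAddHaarMeasure] (p : ℝ≥0∞) {a c : ℝ} (ha : 0 < a)
    (hc : 0 < c) (g : V × W → ℝ≥0∞) :
    eLpNorm (fun v => g (a • v.1, c • v.2)) p (μ.prod ν) =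
      ENNReal.ofReal (a ^ (-(Module.finrank ℝ V * p⁻¹.toReal)) *
        c ^ (-(Module.finrank ℝ W * p⁻¹.toReal))) * eLpNorm g p (μ.prod ν) := by
  have hmap : (μ.prod ν).map ((homothetyEquiv V a ha).prodCongr (homothetyEquiv W c hc)) =
      (ENNReal.ofReal (a ^ (-(Module.finrank ℝ V : ℝ))) *
        ENNReal.ofReal (c ^ (-(Module.finrank ℝ W : ℝ)))) • μ.prod ν := by
    have h0 : (((homothetyEquiv V a ha).prodCongr (homothetyEquiv W c hc) : V × W ≃ᵐ V × W) :
      V × W → V × W) = Prod.map (homothetyEquiv V a ha) (homothetyEquiv W c hc) := rfl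
    rw [h0, ← Measure.map_prod_map _ _ (homothetyEquiv V a ha).measurable
      (homothetyEquiv W c hc).measurable, map_homothetyEquiv, map_homothetyEquiv,
      Measure.prod_smul_left, Measure.prod_smul_right, smul_smul]
  have h := eLpNorm_ennreal_comp (p := p)
    ((homothetyEquiv V a ha).prodCongr (homothetyEquiv W c hc)) (mul_ne_zero
    (ENNReal.ofReal_pos.2 (Real.rpow_pos_of_pos ha _)).ne' (ENNReal.ofReal_pos.2 (Real.rpow_pos_of_pos hc _)).ne') hmap g
  rw [← ENNReal.ofReal_mul (by positivity), ENNReal.ofReal_rpow_of_pos (by positivity),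
    Real.mul_rpow (by positivity) (by positivity), ← Real.rpow_mul ha.le, ← Real.rpow_mul hc.le,
    neg_mul, neg_mul] at h
  exact h

/-- The homogeneity degree of the quasi-norm of `A^{p,q}_s(D)`. -/
def degreeA (E F : Type*) [NormedAddCommGroup E] [InnerProductSpace ℂ E] [NormedAddCommGroup F]
    [InnerProductSpace ℝ F] (p : ℝ≥0∞) (s : Fin r → ℝ) : ℝ :=
  ∑ j, s j + Module.finrank ℝ F * p⁻¹.toReal + Module.finrank ℝ E / 2 * p⁻¹.toReal

/-- The homogeneity degree of the quasi-norm of `𝒜^{p,q}_s(D)`. -/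
def degreeB (E F : Type*) [NormedAddCommGroup E] [InnerProductSpace ℂ E] [NormedAddCommGroup F]
    [InnerProductSpace ℝ F] (p q : ℝ≥0∞) (s : Fin r → ℝ) : ℝ :=
  ∑ j, s j + Module.finrank ℝ F * p⁻¹.toReal + Module.finrank ℝ E / 2 * q⁻¹.toReal

theorem sqrt_rpow_neg {a : ℝ} (ha : 0 < a) (n t : ℝ) : √a ^ (-(n * t)) = a ^ (-(n / 2 * t)) := by
  rw [Real.sqrt_eq_rpow, ← Real.rpow_mul ha.le]
  congr 1
  ring

theorem normA_dilate (hdb : P.IsInvariantExponents d b) (hq : q ≠ 0) {a : ℝ} (ha : 0 < a)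
    (K : E → F → F → ℝ≥0∞) :
    P.normA d p q s (fun ζ x h => K (√a • ζ) (a • x) (a • h)) =
      ENNReal.ofReal (a ^ (-degreeA E F p s)) * P.normA d p q s K := by
  unfold normA
  have h1 : ∀ h, eLpNorm (fun n : E × F => K (√a • n.1) (a • n.2) (a • h)) p
      ((complexLebesgue E).prod volume) = _ := fun h =>
    eLpNorm_homothety_prod (complexLebesgue E) (volume : Measure F) p (Real.sqrt_pos.2 ha) ha
      (fun n => K n.1 n.2 (a • h))
  simp_rw [h1]
  rw [P.coneNorm_const_mul hq ENNReal.ofReal_ne_top, P.coneNorm_homothety hdb hq ha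
    (fun h => eLpNorm (fun n : E × F => K n.1 n.2 h) p ((complexLebesgue E).prod volume)),
    ← mul_assoc, ← ENNReal.ofReal_mul (by positivity), sqrt_rpow_neg ha, ← Real.rpow_add ha,
    ← Real.rpow_add ha]
  congr 3
  unfold degreeA
  ring

theorem normB_dilate (hdb : P.IsInvariantExponents d b) (hq : q ≠ 0) {a : ℝ} (ha : 0 < a)
    (K : E → F → F → ℝ≥0∞) :
    P.normB d p q s (fun ζ x h => K (√a • ζ) (a • x) (a • h)) =
      ENNReal.ofReal (a ^ (-degreeB E F p q s)) * P.normB d p q s K := by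
  unfold normB
  have h1 : ∀ (ζ : E) (h : F), eLpNorm (fun x => K (√a • ζ) (a • x) (a • h)) p volume = _ :=
    fun ζ h => eLpNorm_homothety (volume : Measure F) p ha (fun x => K (√a • ζ) x (a • h))
  have h2 : ∀ ζ : E, P.coneNorm d q s
      (fun h => eLpNorm (fun x => K (√a • ζ) (a • x) (a • h)) p volume) =
      ENNReal.ofReal (a ^ (-(Module.finrank ℝ F * p⁻¹.toReal)) * a ^ (-∑ j, s j)) *
      P.coneNorm d q s (fun h => eLpNorm (fun x => K (√a • ζ) x h) p volume) := by
    intro ζ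
    simp_rw [h1]
    rw [P.coneNorm_const_mul hq ENNReal.ofReal_ne_top, P.coneNorm_homothety hdb hq ha
      (fun h => eLpNorm (fun x => K (√a • ζ) x h) p volume), ← mul_assoc,
      ← ENNReal.ofReal_mul (by positivity)]
  simp_rw [h2]
  rw [eLpNorm_ennreal_const_mul hq _ ENNReal.ofReal_ne_top,
    eLpNorm_homothety (complexLebesgue E) q (Real.sqrt_pos.2 ha)
    (fun ζ => P.coneNorm d q s (fun h => eLpNorm (fun x => K ζ x h) p volume)), ← mul_assoc,
    ← ENNReal.ofReal_mul (by positivity), sqrt_rpow_neg ha, ← Real.rpow_add ha, ← Real.rpow_add ha]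
  congr 3
  unfold degreeB
  ring

theorem normA_tsum_le (hp : p ≠ 0) (hq : q ≠ 0) {K : ℕ → E → F → F → ℝ≥0∞}
    (hK : ∀ k, Measurable fun w : E × F × F => K k w.1 w.2.1 w.2.2) :
    P.normA d p q s (fun ζ x h => ∑' k, K k ζ x h) ≤
      tsumConst p * tsumConst q * ∑' k, 64 ^ k * P.normA d p q s (K k) := by
  have h1 : ∀ h : F, eLpNorm (fun n : E × F => ∑' k, K k n.1 n.2 h) p
      ((complexLebesgue E).prod volume) ≤ tsumConst p * ∑' k, 4 ^ k *
      eLpNorm (fun n : E × F => K k n.1 n.2 h) p ((complexLebesgue E).prod volume) := by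
    intro h
    refine eLpNorm_ennreal_tsum_le hp _ (g := fun k (n : E × F) => K k n.1 n.2 h) fun k => ?_
    exact (hK k).comp (measurable_fst.prodMk (measurable_snd.prodMk measurable_const))
  refine (P.coneNorm_mono fun h _ => h1 h).trans ?_
  rw [P.coneNorm_const_mul hq (tsumConst_ne_top hp), mul_assoc]
  refine mul_le_mul_right ?_ _
  refine (P.coneNorm_tsum_le hq fun k => (measurable_eLpNorm_slice (hK k) hp).const_mul _).trans ?_
  refine mul_le_mul_right (ENNReal.tsum_le_tsum fun k => ?_) _
  rw [P.coneNorm_const_mul hq (by simp), ← mul_assoc, ← mul_pow]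
  exact mul_le_mul_left (pow_le_pow_left₀ zero_le (by norm_num) _) _

theorem normB_tsum_le (hp : p ≠ 0) (hq : q ≠ 0) {K : ℕ → E → F → F → ℝ≥0∞}
    (hK : ∀ k, Measurable fun w : E × F × F => K k w.1 w.2.1 w.2.2) :
    P.normB d p q s (fun ζ x h => ∑' k, K k ζ x h) ≤
      tsumConst p * tsumConst q * tsumConst q * ∑' k, 64 ^ k * P.normB d p q s (K k) := by
  have h1 : ∀ (ζ : E) (h : F), eLpNorm (fun x => ∑' k, K k ζ x h) p volume ≤
      tsumConst p * ∑' k, 4 ^ k * eLpNorm (K k ζ · h) p volume := by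
    intro ζ h
    refine eLpNorm_ennreal_tsum_le hp _ (g := fun k x => K k ζ x h) fun k => ?_
    exact (hK k).comp (measurable_const.prodMk (measurable_id.prodMk measurable_const))
  have hm : ∀ k, Measurable fun w : E × F => 4 ^ k * eLpNorm (K k w.1 · w.2) p volume :=
    fun k => (measurable_eLpNorm_fibre (hK k) hp).const_mul _
  have h2 : ∀ ζ : E, P.coneNorm d q s (fun h => eLpNorm (fun x => ∑' k, K k ζ x h) p volume) ≤
      tsumConst p * tsumConst q *
      ∑' k, 16 ^ k * P.coneNorm d q s (fun h => eLpNorm (K k ζ · h) p volume) := by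
    intro ζ
    refine (P.coneNorm_mono fun h _ => h1 ζ h).trans ?_
    rw [P.coneNorm_const_mul hq (tsumConst_ne_top hp), mul_assoc]
    refine mul_le_mul_right ?_ _
    refine (P.coneNorm_tsum_le hq fun k => (hm k).comp measurable_prodMk_left).trans ?_
    refine mul_le_mul_right (ENNReal.tsum_le_tsum fun k => ?_) _
    simp only [Function.comp_def]
    rw [P.coneNorm_const_mul hq (by simp), ← mul_assoc, ← mul_pow]
    exact mul_le_mul_left (pow_le_pow_left₀ zero_le (by norm_num) _) _
  unfold normB
  refine (eLpNorm_ennreal_mono h2).trans ?_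
  rw [eLpNorm_ennreal_const_mul hq _ (ENNReal.mul_ne_top (tsumConst_ne_top hp)
    (tsumConst_ne_top hq)), mul_assoc (tsumConst p * tsumConst q)]
  refine mul_le_mul_right ?_ _
  have hm' : ∀ k, Measurable fun ζ : E => P.coneNorm d q s
      (fun h => eLpNorm (K k ζ · h) p volume) := fun k =>
    P.measurable_coneNorm hq (measurable_eLpNorm_fibre (hK k) hp)
  refine (eLpNorm_ennreal_tsum_le hq _ fun k => (hm' k).const_mul _).trans ?_
  refine mul_le_mul_right (ENNReal.tsum_le_tsum fun k => ?_) _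
  rw [eLpNorm_ennreal_const_mul hq _ (by simp), ← mul_assoc, ← mul_pow]
  exact mul_le_mul_left (pow_le_pow_left₀ zero_le (by norm_num) _) _

/-- The weight is a product of functions of `ζ`, `x` and `h`, so the norm factors into three norms,
each finite for large `L`. -/
theorem exists_normA_decay_lt_top (hdb : P.IsInvariantExponents d b) (hp : p ≠ 0) (hq : q ≠ 0)
    (hfin : P.coneNorm d q s unitBall < ∞) :
    ∃ L₀ : ℝ, ∀ L, L₀ ≤ L →
      P.normA d p q s (fun ζ x h => decay L ζ * decay L x * decay L h) < ∞ := by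
  obtain ⟨L₁, h₁⟩ := exists_eLpNorm_decay_lt_top (complexLebesgue E) hp
  obtain ⟨L₂, h₂⟩ := exists_eLpNorm_decay_lt_top (volume : Measure F) hp
  obtain ⟨L₃, h₃⟩ := P.exists_coneNorm_decay_lt_top (d := d) (s := s) hdb hq hfin
  refine ⟨max L₁ (max L₂ L₃), fun L hL => ?_⟩
  have h1 := h₁ L ((le_max_left _ _).trans hL)
  have h2 := h₂ L (((le_max_left _ _).trans (le_max_right _ _)).trans hL)
  have h3 := h₃ L (((le_max_right _ _).trans (le_max_right _ _)).trans hL)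
  set c₁ := eLpNorm (decay L : E → ℝ≥0∞) p (complexLebesgue E)
  set c₂ := eLpNorm (decay L : F → ℝ≥0∞) p volume
  have e1 : eLpNorm (fun n : E × F => decay L n.1 * decay L n.2) p
      ((complexLebesgue E).prod volume) = c₁ * c₂ := by
    have hm : Measurable fun n : E × F => decay L n.1 * decay L n.2 :=
      ((measurable_decay L).comp measurable_fst).mul ((measurable_decay L).comp measurable_snd)
    have h4 := eLpNorm_ennreal_prod hp (complexLebesgue E) (volume : Measure F) hm
    have h5 : ∀ ζ : E, eLpNorm (fun x : F => decay L ζ * decay L x) p volume = decay L ζ * c₂ :=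
      fun ζ => eLpNorm_ennreal_const_mul hp _ ENNReal.ofReal_ne_top _
    rw [h4]
    simp only [h5]
    exact eLpNorm_ennreal_mul_const hp _ h2.ne _
  have e2 : ∀ h : F, eLpNorm (fun n : E × F => decay L n.1 * decay L n.2 * decay L h) p
      ((complexLebesgue E).prod volume) = c₁ * c₂ * decay L h := fun h => by
    rw [← e1]
    exact eLpNorm_ennreal_mul_const hp _ ENNReal.ofReal_ne_top _
  have e3 : P.normA d p q s (fun ζ x h => decay L ζ * decay L x * decay L h) =
      c₁ * c₂ * P.coneNorm d q s (decay L) := by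
    unfold normA
    simp only [e2]
    exact P.coneNorm_const_mul hq (ENNReal.mul_ne_top h1.ne h2.ne) _
  rw [e3]
  exact ENNReal.mul_lt_top (ENNReal.mul_lt_top h1 h2) h3

theorem normA_ne_zero (hp : p ≠ 0) (hq : q ≠ 0) {K : E → F → F → ℝ≥0∞}
    (hK : Measurable fun w : E × F × F => K w.1 w.2.1 w.2.2)
    (hopen : ∀ h ∈ S.Ω, IsOpen {n : E × F | K n.1 n.2 h ≠ 0})
    (h0 : ∀ ζ, ∀ h ∈ S.Ω, K ζ 0 h ≠ 0) : P.normA d p q s K ≠ 0 := by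
  refine P.coneNorm_ne_zero hq (measurable_eLpNorm_slice hK hp) isOpen_univ
    (by simpa using S.nonempty_Ω) fun h hh _ => ?_
  refine eLpNorm_ennreal_ne_zero hp (A := {n : E × F | K n.1 n.2 h ≠ 0}) ?_ ?_ fun n hn => hn
  · exact hK.comp (measurable_fst.prodMk (measurable_snd.prodMk measurable_const))
  · exact ((hopen h hh).measure_pos _ ⟨(0, 0), h0 0 h hh⟩).ne'

theorem isDilationNorm_normA (hdb : P.IsInvariantExponents d b) (hp : p ≠ 0) (hq : q ≠ 0)
    (hfin : P.coneNorm d q s unitBall < ∞) :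
    S.IsDilationNorm (P.normA d p q s) (degreeA E F p s) where
  mono K K' h := P.coneNorm_mono fun y hy => eLpNorm_ennreal_mono fun n => h _ _ y hy
  const_mul c hc K := by
    unfold normA
    rw [← P.coneNorm_const_mul hq hc]
    congr 1
    ext h
    rw [eLpNorm_ennreal_const_mul hp _ hc]
  dilate a ha K := P.normA_dilate hdb hq ha K
  tsum_le := ⟨tsumConst p * tsumConst q, ENNReal.mul_ne_top (tsumConst_ne_top hp)
    (tsumConst_ne_top hq), fun _ hK => P.normA_tsum_le hp hq hK⟩
  finite := P.exists_normA_decay_lt_top hdb hp hq hfin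
  ne_zero _ hK hopen h0 := P.normA_ne_zero hp hq hK hopen h0

theorem exists_normB_decay_lt_top (hdb : P.IsInvariantExponents d b) (hp : p ≠ 0) (hq : q ≠ 0)
    (hfin : P.coneNorm d q s unitBall < ∞) :
    ∃ L₀ : ℝ, ∀ L, L₀ ≤ L →
      P.normB d p q s (fun ζ x h => decay L ζ * decay L x * decay L h) < ∞ := by
  obtain ⟨L₁, h₁⟩ := exists_eLpNorm_decay_lt_top (complexLebesgue E) hq
  obtain ⟨L₂, h₂⟩ := exists_eLpNorm_decay_lt_top (volume : Measure F) hp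
  obtain ⟨L₃, h₃⟩ := P.exists_coneNorm_decay_lt_top (d := d) (s := s) hdb hq hfin
  refine ⟨max L₁ (max L₂ L₃), fun L hL => ?_⟩
  have h1 := h₁ L ((le_max_left _ _).trans hL)
  have h2 := h₂ L (((le_max_left _ _).trans (le_max_right _ _)).trans hL)
  have h3 := h₃ L (((le_max_right _ _).trans (le_max_right _ _)).trans hL)
  have e : P.normB d p q s (fun ζ x h => decay L ζ * decay L x * decay L h) =
      eLpNorm (decay L : E → ℝ≥0∞) q (complexLebesgue E) *
      (eLpNorm (decay L : F → ℝ≥0∞) p volume * P.coneNorm d q s (decay L)) := by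
    rw [← eLpNorm_ennreal_mul_const hq _ (ENNReal.mul_ne_top h2.ne h3.ne)]
    unfold normB
    congr 1
    ext ζ
    rw [← mul_assoc, ← P.coneNorm_const_mul hq (c := decay L ζ * _)
      (ENNReal.mul_ne_top ENNReal.ofReal_ne_top h2.ne)]
    congr 1
    ext h
    rw [← eLpNorm_ennreal_const_mul hp _ (c := decay L ζ) ENNReal.ofReal_ne_top]
    exact eLpNorm_ennreal_mul_const hp _ ENNReal.ofReal_ne_top _
  rw [e]
  exact ENNReal.mul_lt_top h1 (ENNReal.mul_lt_top h2 h3)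

theorem normB_ne_zero (hp : p ≠ 0) (hq : q ≠ 0) {K : E → F → F → ℝ≥0∞}
    (hK : Measurable fun w : E × F × F => K w.1 w.2.1 w.2.2)
    (hopen : ∀ h ∈ S.Ω, IsOpen {n : E × F | K n.1 n.2 h ≠ 0})
    (h0 : ∀ ζ, ∀ h ∈ S.Ω, K ζ 0 h ≠ 0) : P.normB d p q s K ≠ 0 := by
  have hm : Measurable fun w : E × F => eLpNorm (K w.1 · w.2) p volume :=
    measurable_eLpNorm_fibre hK hp
  have hne : ∀ ζ, ∀ h ∈ S.Ω, eLpNorm (K ζ · h) p volume ≠ 0 := fun ζ h hh => by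
    have hx : Measurable fun x : F => K ζ x h :=
      hK.comp (measurable_const.prodMk (measurable_id.prodMk measurable_const))
    have hU : IsOpen {x : F | K ζ x h ≠ 0} := (hopen h hh).preimage (Continuous.prodMk_right ζ)
    exact eLpNorm_ennreal_ne_zero hp hx (hU.measure_pos volume ⟨0, h0 ζ h hh⟩).ne' fun n hn => hn
  have hc : ∀ ζ, P.coneNorm d q s (fun h => eLpNorm (K ζ · h) p volume) ≠ 0 := fun ζ => by
    have hζ := hm.comp (measurable_prodMk_left (x := ζ))
    have hΩ : ((univ : Set F) ∩ S.Ω).Nonempty := by simpa using S.nonempty_Ω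
    exact P.coneNorm_ne_zero hq hζ isOpen_univ hΩ fun h hh _ => hne ζ h hh
  have hmc : Measurable fun ζ => P.coneNorm d q s fun h => eLpNorm (K ζ · h) p volume :=
    P.measurable_coneNorm hq hm
  exact eLpNorm_ennreal_ne_zero hq hmc (A := univ)
    (isOpen_univ.measure_pos (complexLebesgue E) univ_nonempty).ne' fun ζ _ => hc ζ

theorem isDilationNorm_normB (hdb : P.IsInvariantExponents d b) (hp : p ≠ 0) (hq : q ≠ 0)
    (hfin : P.coneNorm d q s unitBall < ∞) :
    S.IsDilationNorm (P.normB d p q s) (degreeB E F p q s) where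
  mono K K' h := eLpNorm_ennreal_mono fun ζ => P.coneNorm_mono fun y hy =>
    eLpNorm_ennreal_mono fun x => h ζ x y hy
  const_mul c hc K := by
    unfold normB
    rw [← eLpNorm_ennreal_const_mul hq _ hc]
    congr 1
    ext ζ
    rw [← P.coneNorm_const_mul hq hc]
    congr 1
    ext h
    rw [eLpNorm_ennreal_const_mul hp _ hc]
  dilate a ha K := P.normB_dilate hdb hq ha K
  tsum_le := ⟨tsumConst p * tsumConst q * tsumConst q, ENNReal.mul_ne_top (ENNReal.mul_ne_top
    (tsumConst_ne_top hp) (tsumConst_ne_top hq)) (tsumConst_ne_top hq),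
    fun _ hK => P.normB_tsum_le hp hq hK⟩
  finite := P.exists_normB_decay_lt_top hdb hp hq hfin
  ne_zero _ hK hopen h0 := P.normB_ne_zero hp hq hK hopen h0

end TriangularGroup.PowerCharacter

end SiegelDomain

end

/-! ### Functionals positive on the cone and the coercivity they provide. -/

noncomputable section

/-- A continuous positive function which is homogeneous of degree `k` dominates `c ‖v‖ᵏ`. -/
theorem exists_pos_mul_norm_pow_le {V : Type*} [NormedAddCommGroup V] [NormedSpace ℝ V]
    [ProperSpace V] {k : ℕ} {g : V → ℝ} (hg : Continuous g) (h0 : 0 ≤ g 0)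
    (hpos : ∀ v, v ≠ 0 → 0 < g v) (hhom : ∀ a : ℝ, 0 < a → ∀ v, g (a • v) = a ^ k * g v)
    (hk : k ≠ 0) : ∃ c, 0 < c ∧ ∀ v, c * ‖v‖ ^ k ≤ g v := by
  rcases (Metric.sphere (0 : V) 1).eq_empty_or_nonempty with he | hne
  · refine ⟨1, one_pos, fun v => ?_⟩
    by_cases hv : v = 0
    · simpa [hv, hk] using h0
    · have : ‖v‖⁻¹ • v ∈ Metric.sphere (0 : V) 1 := by
        rw [mem_sphere_zero_iff_norm, norm_smul, norm_inv, norm_norm,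
          inv_mul_cancel₀ (norm_ne_zero_iff.2 hv)]
      rw [he] at this
      exact absurd this (notMem_empty _)
  · obtain ⟨v₀, hv₀, hmin⟩ := (isCompact_sphere (0 : V) 1).exists_isMinOn hne hg.continuousOn
    refine ⟨g v₀, hpos v₀ ?_, fun v => ?_⟩
    · rintro rfl
      simp at hv₀
    by_cases hv : v = 0
    · simpa [hv, hk] using h0
    · have hn : 0 < ‖v‖ := norm_pos_iff.2 hv
      have hm : ‖v‖⁻¹ • v ∈ Metric.sphere (0 : V) 1 := by
        rw [mem_sphere_zero_iff_norm, norm_smul, norm_inv, norm_norm, inv_mul_cancel₀ hn.ne']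
      have h1 : g v₀ ≤ g (‖v‖⁻¹ • v) := hmin hm
      have h2 : g v = ‖v‖ ^ k * g (‖v‖⁻¹ • v) := by
        rw [← hhom _ hn, smul_inv_smul₀ hn.ne']
      rw [h2, mul_comm]
      gcongr

namespace SiegelDomain

variable {E F : Type*} [NormedAddCommGroup E] [InnerProductSpace ℂ E]
  [NormedAddCommGroup F] [InnerProductSpace ℝ F] (S : SiegelDomain E F)

/-- If the line through `x` in direction `v` left `Ω`, a hyperplane separating `Ω` from an exit
point would yield a functional positive on `Ω` and nonzero at `v`. Hence the line stays in `Ω`,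
which contains no line. -/
theorem eq_zero_of_forall_pos_functional (v : F)
    (hv : ∀ l : F →L[ℝ] ℝ, (∀ y ∈ S.Ω, 0 < l y) → l v = 0) : v = 0 := by
  obtain ⟨x, hx⟩ := S.nonempty_Ω
  refine S.no_line x v fun a => ?_
  by_contra hxa
  obtain ⟨f, hf⟩ := geometric_hahn_banach_open_point S.Ω.convex S.isOpen_Ω hxa
  have hle : ∀ y ∈ S.Ω, f y ≤ 0 := by
    intro y hy
    by_contra! hpos
    obtain ⟨n, hn⟩ := exists_nat_gt (f (x + a • v) / f y)
    have hlt := hf (((n : ℝ) + 1) • y) (S.Ω.smul_mem (by positivity) hy)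
    rw [map_smul, smul_eq_mul] at hlt
    rw [div_lt_iff₀ hpos] at hn
    linarith
  have hfv : f v ≠ 0 := by
    intro h0
    have := hf x hx
    rw [map_add, map_smul, h0, smul_zero, add_zero] at this
    exact lt_irrefl _ this
  -- Since `Ω` is open, `f ≤ 0` at `y ± (ε / 2) v`; as `f v ≠ 0`, this makes `f y` strictly
  -- negative.
  have hneg : ∀ y ∈ S.Ω, 0 < (-f) y := by
    intro y hy
    have hc : Continuous fun e : ℝ => y + e • v := by fun_prop
    have hopen : IsOpen ((fun e : ℝ => y + e • v) ⁻¹' (S.Ω : Set F)) := S.isOpen_Ω.preimage hc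
    obtain ⟨ε, hε, hball⟩ := Metric.isOpen_iff.1 hopen 0 (by simpa using hy)
    have h1 : y + (ε / 2) • v ∈ S.Ω := hball (by
      rw [mem_ball_zero_iff, Real.norm_of_nonneg (by positivity)]; linarith)
    have h2 : y + (-(ε / 2)) • v ∈ S.Ω := hball (by
      rw [mem_ball_zero_iff, norm_neg, Real.norm_of_nonneg (by positivity)]; linarith)
    have h1' := hle _ h1
    have h2' := hle _ h2
    rw [map_add, map_smul, smul_eq_mul] at h1' h2'
    rw [neg_apply]
    rcases lt_or_gt_of_ne hfv with h | h
    · nlinarith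
    · nlinarith
  have := hv (-f) hneg
  rw [neg_apply, neg_eq_zero] at this
  exact hfv this

/-- The dual is finite-dimensional, so finitely many positive functionals span the same subspace as
all of them, and a vector they kill is killed by every positive functional. -/
theorem exists_finset_functionals [FiniteDimensional ℝ F] :
    ∃ t : Finset (F →L[ℝ] ℝ), (∀ l ∈ t, ∀ y ∈ S.Ω, 0 < l y) ∧
      ∀ v, (∀ l ∈ t, l v = 0) → v = 0 := by
  obtain ⟨t, ht, hspan⟩ := (Submodule.fg_span_iff_fg_span_finset_subset
    {l : F →L[ℝ] ℝ | ∀ y ∈ S.Ω, 0 < l y}).1 (IsNoetherian.noetherian (R := ℝ) _)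
  refine ⟨t, fun l hl => ht hl, fun v hv => S.eq_zero_of_forall_pos_functional v fun l hl => ?_⟩
  have hmem : l ∈ Submodule.span ℝ (t : Set (F →L[ℝ] ℝ)) := hspan ▸ Submodule.subset_span hl
  refine Submodule.span_induction (p := fun l _ => l v = 0) (fun l hl => hv l hl) rfl ?_ ?_ hmem
  · intro l l' _ _ h h'
    rw [add_apply, h, h', add_zero]
  · intro a l _ h
    rw [smul_apply, h, smul_zero]

theorem real_smul_eq (a : ℝ) (ζ : E) : a • ζ = (a : ℂ) • ζ := (Complex.coe_smul a ζ).symm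

theorem quad_add_smul (a : ℝ) (ζ ζ' : E) :
    S.quad (ζ' + a • ζ) = S.quad ζ' + (2 * a) • (S.Φ ζ ζ').re + a ^ 2 • S.quad ζ := by
  have h : (S.Φ ζ' ζ).re = (S.Φ ζ ζ').re := by
    rw [S.hermitian ζ ζ']
    rfl
  unfold quad
  rw [real_smul_eq]
  simp only [map_add, map_smul, LinearMap.add_apply, LinearMap.smul_apply, map_smulₛₗ,
    Complexification.re_add, Complexification.re_smul, Complex.conj_ofReal, Complex.ofReal_re,
    Complex.ofReal_im, zero_smul, sub_zero, h]
  module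

theorem quad_smul (a : ℝ) (ζ : E) : S.quad (a • ζ) = a ^ 2 • S.quad ζ := by
  have h := S.quad_add_smul a ζ 0
  have h0 : S.quad 0 = 0 := by simp [quad]
  simpa [h0] using h

theorem functional_quad_nonneg {l : F →L[ℝ] ℝ} (hl : ∀ y ∈ S.Ω, 0 < l y) (ζ : E) :
    0 ≤ l (S.quad ζ) := by
  have hc : IsClosed {y | 0 ≤ l y} := isClosed_le continuous_const l.continuous
  exact hc.closure_subset_iff.2 (fun y hy => (hl y hy).le) (S.positive ζ)

/-- The form `l ∘ Φ` is positive semidefinite, so its null vectors lie in its radical. Along `ζ' + a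
ζ` it is affine in `a` and nonnegative, hence of slope zero; the chosen `a` would give the value
`-1`. -/
theorem functional_eq_zero_of_quad {l : F →L[ℝ] ℝ} (hl : ∀ y ∈ S.Ω, 0 < l y) {ζ : E}
    (hζ : l (S.quad ζ) = 0) (ζ' : E) : l (S.Φ ζ ζ').re = 0 := by
  by_contra hne
  set A := l (S.quad ζ')
  set B := l (S.Φ ζ ζ').re
  have h := S.functional_quad_nonneg hl (ζ' + (-(A + 1) / (2 * B)) • ζ)
  rw [S.quad_add_smul, map_add, map_add, map_smul, map_smul, hζ, smul_zero, add_zero,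
    smul_eq_mul] at h
  have e : 2 * (-(A + 1) / (2 * B)) * B = -(A + 1) := by field_simp
  change 0 ≤ A + 2 * (-(A + 1) / (2 * B)) * B at h
  rw [e] at h
  linarith

theorem eq_zero_of_functional_quad {t : Finset (F →L[ℝ] ℝ)} (ht : ∀ l ∈ t, ∀ y ∈ S.Ω, 0 < l y)
    (ht' : ∀ v, (∀ l ∈ t, l v = 0) → v = 0) {ζ : E} (hζ : ∀ l ∈ t, l (S.quad ζ) = 0) : ζ = 0 := by
  have hre : ∀ ζ', (S.Φ ζ ζ').re = 0 := fun ζ' =>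
    ht' _ fun l hl => S.functional_eq_zero_of_quad (ht l hl) (hζ l hl) ζ'
  refine S.nondegenerate ζ fun ζ' => ?_
  ext
  · exact hre ζ'
  · have h := hre (Complex.I • ζ')
    rw [map_smulₛₗ, Complexification.re_smul] at h
    simpa using h

/-- On `Ω` one has `l h = |l h|`, so the right side splits into functions of `x`, `h` and `ζ`,
positive off the origin and homogeneous of degrees 1, 1 and 2. Each is bounded below by compactness
of the sphere. -/
theorem exists_bound_functionals [FiniteDimensional ℂ E] [FiniteDimensional ℝ F]
    {t : Finset (F →L[ℝ] ℝ)} (ht : ∀ l ∈ t, ∀ y ∈ S.Ω, 0 < l y)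
    (ht' : ∀ v, (∀ l ∈ t, l v = 0) → v = 0) :
    ∃ c, 0 < c ∧ c ≤ 1 ∧ ∀ ζ : E, ∀ x : F, ∀ h ∈ S.Ω, c * (‖x‖ + (‖h‖ + ‖ζ‖ ^ 2)) ≤
      ∑ l ∈ t, (|l x| + l (S.quad ζ + h)) := by
  have : ProperSpace E := FiniteDimensional.proper ℂ E
  obtain ⟨c₁, hc₁, h₁⟩ := exists_pos_mul_norm_pow_le (V := F) (k := 1)
    (g := fun x => ∑ l ∈ t, |l x|) (by fun_prop) (by simp) (fun v hv => by
      by_contra! hle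
      refine hv (ht' v fun l hl => ?_)
      have h0 := Finset.sum_nonneg fun l (_ : l ∈ t) => abs_nonneg (l v)
      have := (Finset.sum_eq_zero_iff_of_nonneg fun l _ => abs_nonneg (l v)).1 (hle.antisymm h0) l hl
      exact abs_eq_zero.1 this) (fun a ha v => by
      simp_rw [map_smul, smul_eq_mul, abs_mul, abs_of_pos ha, pow_one, Finset.mul_sum]) one_ne_zero
  have hcq : Continuous fun ζ => ∑ l ∈ t, l (S.quad ζ) :=
    continuous_finsetSum _ fun l _ => l.continuous.comp S.continuous_quad
  obtain ⟨c₂, hc₂, h₂⟩ := exists_pos_mul_norm_pow_le (V := E) (k := 2)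
    (g := fun ζ => ∑ l ∈ t, l (S.quad ζ)) hcq
    (Finset.sum_nonneg fun l hl => S.functional_quad_nonneg (ht l hl) 0) (fun ζ hζ => by
      by_contra! hle
      refine hζ (S.eq_zero_of_functional_quad ht ht' fun l hl => ?_)
      have h0 := Finset.sum_nonneg fun l (hl : l ∈ t) => S.functional_quad_nonneg (ht l hl) ζ
      exact (Finset.sum_eq_zero_iff_of_nonneg fun l hl => S.functional_quad_nonneg (ht l hl) ζ).1
        (hle.antisymm h0) l hl) (fun a _ ζ => by
      simp_rw [S.quad_smul, map_smul, smul_eq_mul, Finset.mul_sum]) two_ne_zero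
  -- The cap at `1` lets `c` also multiply the summand `1` in `1 + ∑`, when the kernel is estimated.
  refine ⟨min 1 (min c₁ c₂), lt_min one_pos (lt_min hc₁ hc₂), min_le_left _ _,
    fun ζ x h hh => ?_⟩
  set c := min 1 (min c₁ c₂)
  have hc1 : c ≤ c₁ := (min_le_right _ _).trans (min_le_left _ _)
  have hc2 : c ≤ c₂ := (min_le_right _ _).trans (min_le_right _ _)
  have e : ∑ l ∈ t, (|l x| + l (S.quad ζ + h)) =
      ∑ l ∈ t, |l x| + (∑ l ∈ t, |l h| + ∑ l ∈ t, l (S.quad ζ)) := by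
    rw [← Finset.sum_add_distrib, ← Finset.sum_add_distrib]
    refine Finset.sum_congr rfl fun l hl => ?_
    rw [map_add, abs_of_pos (ht l hl h hh), add_comm (l h)]
  have hx := h₁ x
  have hh' := h₁ h
  have hz := h₂ ζ
  simp only [pow_one] at hx hh'
  rw [e, mul_add, mul_add]
  have e1 : c * ‖x‖ ≤ c₁ * ‖x‖ := by gcongr
  have e2 : c * ‖h‖ ≤ c₁ * ‖h‖ := by gcongr
  have e3 : c * ‖ζ‖ ^ 2 ≤ c₂ * ‖ζ‖ ^ 2 := by gcongr
  linarith

end SiegelDomain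

/-! ### Estimates for products of negative powers on half-planes, uniform in the dilation parameter.
-/

section HalfPlaneKernel

theorem one_add_sum_le_prod {ι : Type*} {t : Finset ι} {f : ι → ℝ} (hf : ∀ i ∈ t, 0 ≤ f i) :
    1 + ∑ i ∈ t, f i ≤ ∏ i ∈ t, (1 + f i) := by
  classical
  induction t using Finset.induction_on with
  | empty => simp
  | insert i t hi ih =>
    have h1 := ih fun j hj => hf j (Finset.mem_insert_of_mem hj)
    have h2 := hf i (Finset.mem_insert_self i t)
    have h3 := Finset.sum_nonneg fun j hj => hf j (Finset.mem_insert_of_mem (a := j) (b := i) hj)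
    rw [Finset.sum_insert hi, Finset.prod_insert hi]
    nlinarith

theorem single_le_finset_prod {ι : Type*} {t : Finset ι} {f : ι → ℝ} (hf : ∀ i ∈ t, 1 ≤ f i)
    {i : ι} (hi : i ∈ t) : f i ≤ ∏ j ∈ t, f j := by
  classical
  rw [← Finset.mul_prod_erase t f hi]
  exact le_mul_of_one_le_right (zero_le_one.trans (hf i hi))
    (Finset.one_le_prod fun j hj => hf j (Finset.mem_of_mem_erase hj))

variable {ι : Type*} (t : Finset ι) (M : ℕ)

/-- `∏ᵢ (1 - i a uᵢ)^(-M)`, for `uᵢ` in the upper half-plane. -/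
def halfPlaneKernel (a : ℝ) (u : ι → ℂ) : ℂ := ((∏ i ∈ t, (1 - Complex.I * a * u i)) ^ M)⁻¹

theorem one_sub_I_mul_re (a : ℝ) (u : ℂ) : (1 - Complex.I * a * u).re = 1 + a * u.im := by
  simp

theorem one_sub_I_mul_im (a : ℝ) (u : ℂ) : (1 - Complex.I * a * u).im = -(a * u.re) := by
  simp

variable {t M} {a : ℝ} {u : ι → ℂ}

theorem re_le_norm_one_sub (a : ℝ) (u : ℂ) : 1 + a * u.im ≤ ‖1 - Complex.I * a * u‖ :=
  (one_sub_I_mul_re a u).symm.le.trans (Complex.re_le_norm _)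

theorem one_le_norm_one_sub (ha : 0 < a) {u : ℂ} (hu : 0 < u.im) : 1 ≤ ‖1 - Complex.I * a * u‖ := by
  have := re_le_norm_one_sub a u
  have := mul_pos ha hu
  linarith

theorem one_sub_ne_zero (ha : 0 < a) {u : ℂ} (hu : 0 < u.im) : 1 - Complex.I * a * u ≠ 0 :=
  norm_ne_zero_iff.1 (one_pos.trans_le (one_le_norm_one_sub ha hu)).ne'

theorem norm_halfPlaneKernel (a : ℝ) (u : ι → ℂ) :
    ‖halfPlaneKernel t M a u‖ = ((∏ i ∈ t, ‖1 - Complex.I * a * u i‖) ^ M)⁻¹ := by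
  rw [halfPlaneKernel, norm_inv, norm_pow, norm_prod]

theorem halfPlaneKernel_ne_zero (ha : 0 < a) (hu : ∀ i ∈ t, 0 < (u i).im) :
    halfPlaneKernel t M a u ≠ 0 :=
  inv_ne_zero (pow_ne_zero _ (Finset.prod_ne_zero_iff.2 fun i hi => one_sub_ne_zero ha (hu i hi)))

theorem one_le_prod_norm (ha : 0 < a) (hu : ∀ i ∈ t, 0 < (u i).im) :
    1 ≤ ∏ i ∈ t, ‖1 - Complex.I * a * u i‖ :=
  Finset.one_le_prod fun i hi => one_le_norm_one_sub ha (hu i hi)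

/-- The bound does not depend on `a`, which makes the lacunary series converge. For `a ≤ 1` both
factors are at most `1`; for `a ≥ 1` a single factor of the product, at least `a Im u`, absorbs `a ^
α` because `α ≤ M`. -/
theorem rpow_mul_norm_halfPlaneKernel_le (ha : 0 < a) (hu : ∀ i ∈ t, 0 < (u i).im) {α : ℝ}
    (hα : 0 ≤ α) (hM : α ≤ M) {i : ι} (hi : i ∈ t) :
    a ^ α * ‖halfPlaneKernel t M a u‖ ≤ 1 + (((u i).im) ^ M)⁻¹ := by
  have hpos : 0 < ((u i).im ^ M)⁻¹ := inv_pos.2 (pow_pos (hu i hi) _)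
  have hP := one_le_prod_norm ha hu
  rw [norm_halfPlaneKernel]
  rcases le_total a 1 with h1 | h1
  · have e1 : a ^ α ≤ 1 := Real.rpow_le_one ha.le h1 hα
    have e2 : ((∏ i ∈ t, ‖1 - Complex.I * a * u i‖) ^ M)⁻¹ ≤ 1 :=
      inv_le_one_of_one_le₀ (one_le_pow₀ hP)
    have e3 := mul_le_one₀ e1 (by positivity) e2
    linarith
  · have e1 : a ^ α ≤ a ^ M := by
      rw [← Real.rpow_natCast]
      exact Real.rpow_le_rpow_of_exponent_le h1 hM
    have e2 : a * (u i).im ≤ ∏ i ∈ t, ‖1 - Complex.I * a * u i‖ := by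
      have e3 : ‖1 - Complex.I * a * u i‖ ≤ ∏ i ∈ t, ‖1 - Complex.I * a * u i‖ :=
        single_le_finset_prod (fun j hj => one_le_norm_one_sub ha (hu j hj)) hi
      linarith [re_le_norm_one_sub a (u i)]
    have e3 : 0 < a * (u i).im := mul_pos ha (hu i hi)
    calc a ^ α * ((∏ i ∈ t, ‖1 - Complex.I * a * u i‖) ^ M)⁻¹
        ≤ a ^ M * ((a * (u i).im) ^ M)⁻¹ := by gcongr
      _ = ((u i).im ^ M)⁻¹ := by
        rw [mul_pow, mul_inv, ← mul_assoc, mul_inv_cancel₀ (pow_pos ha _).ne', one_mul]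
      _ ≤ _ := by linarith

theorem sum_le_prod_norm (hu : ∀ i ∈ t, 0 < (u i).im) :
    (2⁻¹ : ℝ) ^ t.card * (1 + ∑ i ∈ t, (|(u i).re| + (u i).im)) ≤
      ∏ i ∈ t, ‖1 - Complex.I * (1 : ℝ) * u i‖ := by
  have h1 : ∀ i ∈ t, 2⁻¹ * (1 + (|(u i).re| + (u i).im)) ≤ ‖1 - Complex.I * (1 : ℝ) * u i‖ := by
    intro i hi
    have e1 := re_le_norm_one_sub 1 (u i)
    have e2 := Complex.abs_im_le_norm (1 - Complex.I * (1 : ℝ) * u i)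
    rw [one_sub_I_mul_im, abs_neg, one_mul] at e2
    linarith
  calc (2⁻¹ : ℝ) ^ t.card * (1 + ∑ i ∈ t, (|(u i).re| + (u i).im))
      ≤ (2⁻¹ : ℝ) ^ t.card * ∏ i ∈ t, (1 + (|(u i).re| + (u i).im)) := by
        gcongr
        exact one_add_sum_le_prod fun i hi => add_nonneg (abs_nonneg _) (hu i hi).le
    _ = ∏ i ∈ t, 2⁻¹ * (1 + (|(u i).re| + (u i).im)) := by
        rw [Finset.prod_mul_distrib, Finset.prod_const]
    _ ≤ _ := Finset.prod_le_prod (fun i hi => by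
        have := (hu i hi).le
        positivity) h1

/-- The aperture of a sector in which the kernels have real part at least half their modulus. -/
def aperture (t : Finset ι) (M : ℕ) : ℝ := 1 / (4 * (t.card * M + 1))

theorem aperture_pos (t : Finset ι) (M : ℕ) : 0 < aperture t M := by
  unfold aperture
  positivity

/-- In the sector each factor is a positive number times `1 + w` with `‖w‖` at most the aperture,
for every `a`. The aperture is chosen so that the total perturbation over all `card t · M` factors
is at most `1/4`. Hence the product `Q` of the `1 + w` lies within `exp (1/4) - 1 ≤ 1/3` of `1`, and
`2 Re Q ≥ 4/3 ≥ ‖Q‖`. -/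
theorem norm_halfPlaneKernel_le_two_mul_re (ha : 0 < a) (hu : ∀ i ∈ t, 0 < (u i).im)
    (hsec : ∀ i ∈ t, |(u i).re| ≤ aperture t M * (u i).im) :
    ‖halfPlaneKernel t M a u‖ ≤ 2 * (halfPlaneKernel t M a u).re := by
  set w : ι → ℂ := fun i => -(Complex.I * (a * (u i).re / (1 + a * (u i).im) : ℝ)) with hw
  have hY : ∀ i ∈ t, 0 < 1 + a * (u i).im := fun i hi => by
    have := mul_pos ha (hu i hi)
    linarith
  have hfac : ∀ i ∈ t, 1 - Complex.I * a * u i = ((1 + a * (u i).im : ℝ) : ℂ) * (1 + w i) := by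
    intro i hi
    have h0 : ((1 + a * (u i).im : ℝ) : ℂ) ≠ 0 := Complex.ofReal_ne_zero.2 (hY i hi).ne'
    rw [hw]
    simp only
    rw [Complex.ofReal_div, mul_add, mul_one, mul_neg, mul_left_comm, mul_div_cancel₀ _ h0]
    apply Complex.ext <;> simp
  have hwn : ∀ i ∈ t, ‖w i‖ ≤ aperture t M := by
    intro i hi
    rw [hw]
    simp only [norm_neg, norm_mul, Complex.norm_I, one_mul, Complex.norm_real, Real.norm_eq_abs]
    rw [abs_div, abs_of_pos (hY i hi), div_le_iff₀ (hY i hi), abs_mul, abs_of_pos ha]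
    have h1 := mul_le_mul_of_nonneg_left (hsec i hi) ha.le
    have h2 := aperture_pos t M
    nlinarith
  set Q : ℂ := (∏ i ∈ t, (1 + w i)) ^ M with hQ
  have hQ1 : ‖Q - 1‖ ≤ 1 / 3 := by
    have e : Q = ∏ z ∈ t ×ˢ Finset.range M, (1 + w z.1) := by
      rw [Finset.prod_product, hQ, ← Finset.prod_pow]
      simp
    rw [e]
    refine (Finset.norm_prod_one_add_sub_one_le _ _).trans ?_
    have h1 : ∑ z ∈ t ×ˢ Finset.range M, ‖w z.1‖ ≤ 1 / 4 := by
      calc ∑ z ∈ t ×ˢ Finset.range M, ‖w z.1‖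
          ≤ ∑ z ∈ t ×ˢ Finset.range M, aperture t M :=
            Finset.sum_le_sum fun z hz => hwn z.1 (Finset.mem_product.1 hz).1
        _ = t.card * M * aperture t M := by simp [Finset.card_product]
        _ ≤ 1 / 4 := by
          unfold aperture
          rw [mul_one_div, div_le_div_iff₀ (by positivity) (by positivity)]
          linarith
    have h2 : Real.exp (1 / 4) ≤ 1 / (1 - 1 / 4) :=
      Real.exp_bound_div_one_sub_of_interval (by norm_num) (by norm_num)
    have h3 := Real.exp_le_exp.2 h1
    norm_num at h2
    linarith
  set R : ℝ := (∏ i ∈ t, (1 + a * (u i).im)) ^ M with hR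
  have hRpos : 0 < R := pow_pos (Finset.prod_pos hY) _
  have hker : halfPlaneKernel t M a u = ((R⁻¹ : ℝ) : ℂ) * Q⁻¹ := by
    rw [halfPlaneKernel, Finset.prod_congr rfl hfac, Finset.prod_mul_distrib, mul_pow, mul_inv,
      Complex.ofReal_inv, hR, Complex.ofReal_pow, Complex.ofReal_prod]
  have hre : 2 / 3 ≤ Q.re := by
    have h := (Complex.abs_re_le_norm (Q - 1)).trans hQ1
    rw [Complex.sub_re, Complex.one_re, abs_le] at h
    linarith
  have hnorm : ‖Q‖ ≤ 4 / 3 := by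
    have h := norm_add_le (Q - 1) 1
    rw [sub_add_cancel, norm_one] at h
    linarith
  have hQpos : 0 < ‖Q‖ := lt_of_lt_of_le (by linarith) (Complex.re_le_norm Q)
  rw [hker, norm_mul, Complex.norm_real, Real.norm_of_nonneg (inv_nonneg.2 hRpos.le), norm_inv,
    Complex.re_ofReal_mul, Complex.inv_re, Complex.normSq_eq_norm_sq, mul_left_comm]
  refine mul_le_mul_of_nonneg_left ?_ (inv_nonneg.2 hRpos.le)
  rw [← mul_div_assoc, le_div_iff₀ (by positivity), sq, ← mul_assoc, inv_mul_cancel₀ hQpos.ne',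
    one_mul]
  linarith

end HalfPlaneKernel

end

/-! ### Holomorphy of the lacunary series, by bounds on logarithmic derivatives. -/

noncomputable section

section LogDeriv

variable {V : Type*} [NormedAddCommGroup V] [NormedSpace ℂ V]

/-- `f` is differentiable at `w` and its logarithmic derivative is bounded by `B`. -/
def HasLogDerivBound (f : V → ℂ) (w : V) (B : ℝ) : Prop :=
  ∃ f' : V →L[ℂ] ℂ, HasFDerivAt f f' w ∧ ‖f'‖ ≤ ‖f w‖ * B

namespace HasLogDerivBound

variable {f g : V → ℂ} {w : V} {B C : ℝ}

theorem mul (hf : HasLogDerivBound f w B) (hg : HasLogDerivBound g w C) :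
    HasLogDerivBound (fun v => f v * g v) w (B + C) := by
  obtain ⟨f', hf', hfB⟩ := hf
  obtain ⟨g', hg', hgC⟩ := hg
  refine ⟨_, hf'.mul hg', (norm_add_le _ _).trans ?_⟩
  rw [norm_smul, norm_smul, norm_mul]
  have h1 := mul_le_mul_of_nonneg_left hgC (norm_nonneg (f w))
  have h2 := mul_le_mul_of_nonneg_left hfB (norm_nonneg (g w))
  linarith

theorem prod {ι : Type*} {t : Finset ι} {f : ι → V → ℂ} {B : ι → ℝ}
    (hf : ∀ i ∈ t, HasLogDerivBound (f i) w (B i)) :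
    HasLogDerivBound (fun v => ∏ i ∈ t, f i v) w (∑ i ∈ t, B i) := by
  classical
  induction t using Finset.induction_on with
  | empty =>
    refine ⟨0, ?_, by simp⟩
    simpa using hasFDerivAt_const (1 : ℂ) w
  | insert i t hi ih =>
    have h := (hf i (Finset.mem_insert_self i t)).mul
      (ih fun j hj => hf j (Finset.mem_insert_of_mem hj))
    simpa only [Finset.prod_insert hi, Finset.sum_insert hi] using h

theorem pow (hf : HasLogDerivBound f w B) (n : ℕ) :
    HasLogDerivBound (fun v => f v ^ n) w (n * B) := by
  have h := prod (t := Finset.range n) (f := fun _ => f) (B := fun _ => B) fun _ _ => hf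
  simpa using h

theorem inv (hf : HasLogDerivBound f w B) (h0 : f w ≠ 0) :
    HasLogDerivBound (fun v => (f v)⁻¹) w B := by
  obtain ⟨f', hf', hfB⟩ := hf
  have hn : 0 < ‖f w‖ := norm_pos_iff.2 h0
  refine ⟨_, (hasDerivAt_inv h0).comp_hasFDerivAt w hf', ?_⟩
  rw [norm_smul, norm_neg, norm_inv, norm_pow, norm_inv]
  calc (‖f w‖ ^ 2)⁻¹ * ‖f'‖ ≤ (‖f w‖ ^ 2)⁻¹ * (‖f w‖ * B) := by gcongr
    _ = ‖f w‖⁻¹ * B := by field_simp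

end HasLogDerivBound

/-- The parameter `a` drops out: a factor has derivative of norm `a ‖ψ‖` and modulus at least `a Im
ψ`. Logarithmic derivatives add over products and keep their size under inversion. -/
theorem hasLogDerivBound_halfPlaneKernel {ι : Type*} {t : Finset ι} {M : ℕ} {a : ℝ} (ha : 0 < a)
    (ψ : ι → V →L[ℂ] ℂ) {w : V} (hw : ∀ i ∈ t, 0 < (ψ i w).im) :
    HasLogDerivBound (fun v => halfPlaneKernel t M a fun i => ψ i v) w
      (M * ∑ i ∈ t, ‖ψ i‖ / (ψ i w).im) := by
  have hfac : ∀ i ∈ t, HasLogDerivBound (fun v => 1 - Complex.I * a * ψ i v) w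
      (‖ψ i‖ / (ψ i w).im) := by
    intro i hi
    refine ⟨-((Complex.I * a) • ψ i), ?_, ?_⟩
    · exact ((ψ i).hasFDerivAt.const_smul (Complex.I * (a : ℂ))).const_sub 1
    · rw [norm_neg, norm_smul, norm_mul, Complex.norm_I, one_mul, Complex.norm_real,
        Real.norm_of_nonneg ha.le]
      have h1 := re_le_norm_one_sub a (ψ i w)
      have h2 : a * (ψ i w).im ≤ ‖1 - Complex.I * a * ψ i w‖ := by linarith
      calc a * ‖ψ i‖ = a * (ψ i w).im * (‖ψ i‖ / (ψ i w).im) := by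
            have := (hw i hi).ne'
            field_simp
        _ ≤ _ := mul_le_mul_of_nonneg_right h2 (div_nonneg (norm_nonneg _) (hw i hi).le)
  refine ((HasLogDerivBound.prod hfac).pow M).inv ?_
  exact pow_ne_zero _ (Finset.prod_ne_zero_iff.2 fun i hi => one_sub_ne_zero ha (hw i hi))

/-- A sum of dilated kernels is holomorphic on a product of half-planes. -/
theorem differentiableAt_tsum_halfPlaneKernel {ι : Type*} {t : Finset ι} {M : ℕ}
    (ψ : ι → V →L[ℂ] ℂ) {α : ℝ} (hα : 0 ≤ α) (hM : α ≤ M) {a : ℕ → ℝ} (ha : ∀ k, 0 < a k)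
    {δ : ℕ → ℝ} (hδ : Summable δ) (hδ0 : ∀ k, 0 ≤ δ k) (hne : t.Nonempty) {w : V}
    (hw : ∀ i ∈ t, 0 < (ψ i w).im) :
    (Summable fun k => ((δ k * a k ^ α : ℝ) : ℂ) * halfPlaneKernel t M (a k) fun i => ψ i w) ∧
    DifferentiableAt ℂ (fun v => ∑' k, ((δ k * a k ^ α : ℝ) : ℂ) *
      halfPlaneKernel t M (a k) fun i => ψ i v) w := by
  obtain ⟨i₀, hi₀⟩ := hne
  -- On this neighbourhood of `w` the imaginary parts are bounded below, so the estimates are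
  -- uniform in `k` and `v`. It is convex, hence preconnected, as termwise differentiation requires.
  set U : Set V := {v | ∀ i ∈ t, (ψ i w).im / 2 < (ψ i v).im} with hU
  have hpos : ∀ v ∈ U, ∀ i ∈ t, 0 < (ψ i v).im := fun v hv i hi =>
    (half_pos (hw i hi)).trans (hv i hi)
  have hUeq : U = ⋂ i ∈ t, {v | (ψ i w).im / 2 < (ψ i v).im} := by
    ext v
    simp [hU]
  have hopen : IsOpen U := by
    rw [hUeq]
    refine isOpen_biInter_finset fun i _ => ?_
    exact isOpen_lt continuous_const (Complex.continuous_im.comp (ψ i).continuous)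
  have hconv : Convex ℝ U := by
    rw [hUeq]
    refine convex_iInter₂ fun i _ => ?_
    have hlin : IsLinearMap ℝ fun v => (ψ i v).im :=
      ⟨fun v v' => by simp, fun c v => by
        rw [← Complex.coe_smul c v, map_smul]
        simp⟩
    exact convex_halfSpace_gt hlin _
  have hwU : w ∈ U := fun i hi => half_lt_self (hw i hi)
  set C : ℝ := 1 + (((ψ i₀ w).im / 2) ^ M)⁻¹ with hC
  have hC0 : 0 ≤ C := by
    have := hw i₀ hi₀
    positivity
  have hbound : ∀ k, ∀ v ∈ U, ‖((δ k * a k ^ α : ℝ) : ℂ)‖ *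
      ‖halfPlaneKernel t M (a k) fun i => ψ i v‖ ≤ δ k * C := by
    intro k v hv
    rw [Complex.norm_real, Real.norm_of_nonneg (mul_nonneg (hδ0 k) (Real.rpow_nonneg (ha k).le _)),
      mul_assoc]
    refine mul_le_mul_of_nonneg_left ?_ (hδ0 k)
    refine (rpow_mul_norm_halfPlaneKernel_le (ha k) (hpos v hv) hα hM hi₀).trans ?_
    have h1 := hw i₀ hi₀
    have h2 := hv i₀ hi₀
    rw [hC]
    gcongr
  have hsum : ∀ v ∈ U, Summable fun k => ((δ k * a k ^ α : ℝ) : ℂ) *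
      halfPlaneKernel t M (a k) fun i => ψ i v := fun v hv => by
    refine Summable.of_norm_bounded (hδ.mul_right C) fun k => ?_
    rw [norm_mul]
    exact hbound k v hv
  refine ⟨hsum w hwU, ?_⟩
  set B : ℝ := M * ∑ i ∈ t, ‖ψ i‖ / ((ψ i w).im / 2) with hB
  have hex : ∀ k, ∀ v : V, ∃ g' : V →L[ℂ] ℂ, v ∈ U →
      HasFDerivAt (fun v => ((δ k * a k ^ α : ℝ) : ℂ) * halfPlaneKernel t M (a k) fun i => ψ i v)
        g' v ∧ ‖g'‖ ≤ δ k * C * B := by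
    intro k v
    by_cases hv : v ∈ U
    · obtain ⟨g', hg', hn⟩ := hasLogDerivBound_halfPlaneKernel (M := M) (ha k) ψ (hpos v hv)
      refine ⟨((δ k * a k ^ α : ℝ) : ℂ) • g', fun _ => ⟨hg'.const_mul _, ?_⟩⟩
      rw [norm_smul]
      calc _ ≤ ‖((δ k * a k ^ α : ℝ) : ℂ)‖ * (‖halfPlaneKernel t M (a k) fun i => ψ i v‖ *
              (M * ∑ i ∈ t, ‖ψ i‖ / (ψ i v).im)) := by gcongr
        _ ≤ ‖((δ k * a k ^ α : ℝ) : ℂ)‖ * (‖halfPlaneKernel t M (a k) fun i => ψ i v‖ * B) := by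
            rw [hB]
            gcongr with i hi
            · exact half_pos (hw i hi)
            · exact (hv i hi).le
        _ = ‖((δ k * a k ^ α : ℝ) : ℂ)‖ * ‖halfPlaneKernel t M (a k) fun i => ψ i v‖ * B := by ring
        _ ≤ δ k * C * B := by
            refine mul_le_mul_of_nonneg_right (hbound k v hv) ?_
            refine mul_nonneg (Nat.cast_nonneg _) (Finset.sum_nonneg fun i hi => ?_)
            exact div_nonneg (norm_nonneg _) (half_pos (hw i hi)).le
    · exact ⟨0, fun h => absurd h hv⟩
  choose g' hg' using hex
  exact (hasFDerivAt_tsum_of_isPreconnected ((hδ.mul_right C).mul_right B) hopen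
    hconv.isPreconnected (fun k v hv => (hg' k v hv).1) (fun k v hv => (hg' k v hv).2) hwU
    (hsum w hwU) hwU).differentiableAt

end LogDeriv

namespace Complexification

variable {F : Type*} [NormedAddCommGroup F] [InnerProductSpace ℝ F]

/-- The `ℂ`-linear extension of a real functional. -/
def extend (l : F →L[ℝ] ℝ) : Complexification F →L[ℂ] ℂ where
  toFun z := ⟨l z.re, l z.im⟩
  map_add' z w := by apply Complex.ext <;> simp
  map_smul' c z := by apply Complex.ext <;> simp
  cont := by
    have h : (fun z : Complexification F => (⟨l z.re, l z.im⟩ : ℂ)) =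
        fun z => (l z.re : ℂ) + (l z.im : ℂ) * Complex.I := by
      ext z
      exact Complex.mk_eq_add_mul_I _ _
    change Continuous fun z : Complexification F => (⟨l z.re, l z.im⟩ : ℂ)
    rw [h]
    exact (Complex.continuous_ofReal.comp (l.continuous.comp continuous_re)).add
      ((Complex.continuous_ofReal.comp (l.continuous.comp continuous_im)).mul continuous_const)

@[simp] theorem extend_re (l : F →L[ℝ] ℝ) (z : Complexification F) : (extend l z).re = l z.re := rfl
@[simp] theorem extend_im (l : F →L[ℝ] ℝ) (z : Complexification F) : (extend l z).im = l z.im := rfl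

end Complexification

end

/-! ### The kernels on the domain and the separating function. -/

noncomputable section

namespace SiegelDomain

variable {E F : Type*} [NormedAddCommGroup E] [InnerProductSpace ℂ E]
  [NormedAddCommGroup F] [InnerProductSpace ℝ F] (S : SiegelDomain E F)

/-- The functions `(ζ, z) ↦ ∏ₗ (1 - i a l(z))^(-M)` on `D`. -/
def kernel (E : Type*) {F : Type*} [NormedAddCommGroup E] [InnerProductSpace ℂ E]
    [NormedAddCommGroup F] [InnerProductSpace ℝ F] (t : Finset (F →L[ℝ] ℝ)) (M : ℕ) (a : ℝ)
    (w : E × Complexification F) : ℂ :=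
  halfPlaneKernel t M a fun l =>
    ((Complexification.extend l).comp (ContinuousLinearMap.snd ℂ E (Complexification F))) w

theorem kernel_eq (t : Finset (F →L[ℝ] ℝ)) (M : ℕ) (a : ℝ) (w : E × Complexification F) :
    kernel E t M a w = halfPlaneKernel t M a fun l => Complexification.extend l w.2 := rfl

variable {S} {t : Finset (F →L[ℝ] ℝ)} {M : ℕ}

theorem functional_im_pos (ht : ∀ l ∈ t, ∀ y ∈ S.Ω, 0 < l y) (ζ : E) {h : F} (hh : h ∈ S.Ω)
    {l : F →L[ℝ] ℝ} (hl : l ∈ t) : 0 < l (S.quad ζ + h) := by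
  rw [map_add]
  exact add_pos_of_nonneg_of_pos (S.functional_quad_nonneg (ht l hl) ζ) (ht l hl h hh)

theorem functional_im_pos_of_mem_domain (ht : ∀ l ∈ t, ∀ y ∈ S.Ω, 0 < l y)
    {w : E × Complexification F} (hw : w ∈ S.domain) {l : F →L[ℝ] ℝ} (hl : l ∈ t) :
    0 < l w.2.im := by
  have h := functional_im_pos ht w.1 (h := S.rho w) hw hl
  rwa [rho, add_sub_cancel] at h

/-- `Φ` is quadratic, so multiplying `z` by `a` is, in the coordinates, the dilation with `√a` on
`E`. The kernels are thus the dilates of a single one. -/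
theorem kernel_dilate (t : Finset (F →L[ℝ] ℝ)) (M : ℕ) {a : ℝ} (ha : 0 < a) (ζ : E) (x h : F) :
    kernel E t M a (ζ, Complexification.ofReIm x (S.quad ζ + h)) =
      kernel E t M 1 (√a • ζ, Complexification.ofReIm (a • x) (S.quad (√a • ζ) + a • h)) := by
  rw [kernel_eq, kernel_eq, S.quad_smul, Real.sq_sqrt ha.le]
  unfold halfPlaneKernel
  congr 2
  refine Finset.prod_congr rfl fun l _ => ?_
  congr 1
  apply Complex.ext <;> simp [mul_add]

theorem coord_kernel_dilate (t : Finset (F →L[ℝ] ℝ)) (M : ℕ) {a : ℝ} (ha : 0 < a) (ζ : E) (x : F)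
    {h : F} (hh : h ∈ S.Ω) :
    S.coord (kernel E t M a) ζ x h = S.coord (kernel E t M 1) (√a • ζ) (a • x) (a • h) := by
  rw [S.coord_of_mem _ _ _ hh, S.coord_of_mem _ _ _ (S.Ω.smul_mem ha hh), kernel_dilate t M ha]

theorem continuousOn_kernel (ht : ∀ l ∈ t, ∀ y ∈ S.Ω, 0 < l y) {a : ℝ} (ha : 0 < a) :
    ContinuousOn (kernel E t M a) S.domain := by
  intro w hw
  obtain ⟨f', hf', -⟩ := hasLogDerivBound_halfPlaneKernel (t := t) (M := M) ha (fun l =>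
    (Complexification.extend l).comp (ContinuousLinearMap.snd ℂ E (Complexification F)))
    (w := w) fun l hl => functional_im_pos_of_mem_domain ht hw hl
  exact hf'.continuousAt.continuousWithinAt

/-- The part of `|kernel|` in the sector where the kernels have comparable real part. -/
def sectorKernel (S : SiegelDomain E F) (t : Finset (F →L[ℝ] ℝ)) (M : ℕ) (ζ : E) (x h : F) :
    ℝ≥0∞ :=
  {w : E × F × F | ∀ l ∈ t, |l w.2.1| < aperture t M * l (S.quad w.1 + w.2.2)}.indicator
    (fun w => S.coord (kernel E t M 1) w.1 w.2.1 w.2.2) (ζ, x, h)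

theorem isOpen_sector [FiniteDimensional ℂ E] :
    IsOpen {w : E × F × F | ∀ l ∈ t, |l w.2.1| < aperture t M * l (S.quad w.1 + w.2.2)} := by
  have : {w : E × F × F | ∀ l ∈ t, |l w.2.1| < aperture t M * l (S.quad w.1 + w.2.2)} =
      ⋂ l ∈ t, {w : E × F × F | |l w.2.1| < aperture t M * l (S.quad w.1 + w.2.2)} := by
    ext w
    simp
  rw [this]
  refine isOpen_biInter_finset fun l _ => ?_
  have hq := S.continuous_quad
  exact isOpen_lt (by fun_prop) (by fun_prop)

section

variable [FiniteDimensional ℂ E] [MeasurableSpace E] [BorelSpace E]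
  [FiniteDimensional ℝ F] [MeasurableSpace F] [BorelSpace F]

theorem measurable_sectorKernel (ht : ∀ l ∈ t, ∀ y ∈ S.Ω, 0 < l y) :
    Measurable fun w : E × F × F => S.sectorKernel t M w.1 w.2.1 w.2.2 := by
  have : ProperSpace E := FiniteDimensional.proper ℂ E
  exact (S.measurable_coord (continuousOn_kernel ht one_pos)).indicator isOpen_sector.measurableSet

theorem coord_kernel_ne_zero (ht : ∀ l ∈ t, ∀ y ∈ S.Ω, 0 < l y) (ζ : E) (x : F) {h : F}
    (hh : h ∈ S.Ω) : S.coord (kernel E t M 1) ζ x h ≠ 0 := by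
  rw [S.coord_of_mem _ _ _ hh, enorm_ne_zero]
  exact halfPlaneKernel_ne_zero one_pos fun l hl => functional_im_pos ht ζ hh hl

theorem IsDilationNorm.sectorKernel_ne_zero {N : (E → F → F → ℝ≥0∞) → ℝ≥0∞} {α : ℝ}
    (hN : S.IsDilationNorm N α) (ht : ∀ l ∈ t, ∀ y ∈ S.Ω, 0 < l y) :
    N (S.sectorKernel t M) ≠ 0 := by
  refine hN.ne_zero _ (measurable_sectorKernel ht) (fun h hh => ?_) fun ζ h hh => ?_
  · have hc : Continuous fun n : E × F => (n.1, n.2, h) := by fun_prop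
    convert (isOpen_sector (S := S) (t := t) (M := M)).preimage hc using 1
    ext n
    simp only [sectorKernel, mem_ofPred_eq, mem_preimage, indicator_apply_ne_zero, mem_inter_iff,
      Function.mem_support]
    exact ⟨fun h => h.1, fun h' => ⟨h', coord_kernel_ne_zero ht _ _ hh⟩⟩
  · rw [sectorKernel, indicator_of_mem]
    · exact coord_kernel_ne_zero ht _ _ hh
    · intro l hl
      rw [map_zero, abs_zero]
      exact mul_pos (aperture_pos t M) (functional_im_pos ht ζ hh hl)

/-- The product of the moduli dominates `1 + ‖x‖ + ‖h‖ + ‖ζ‖ ^ 2`, hence each of the three variables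
separately. Of the exponent `3 * L`, one share `L` is spent on each variable. -/
theorem exists_coord_kernel_le (ht : ∀ l ∈ t, ∀ y ∈ S.Ω, 0 < l y)
    (ht' : ∀ v, (∀ l ∈ t, l v = 0) → v = 0) (L : ℕ) :
    ∃ C : ℝ≥0∞, C ≠ ∞ ∧ ∀ ζ x, ∀ h ∈ S.Ω, S.coord (kernel E t (3 * L) 1) ζ x h ≤
      C * (decay (L : ℝ) ζ * decay (L : ℝ) x * decay (L : ℝ) h) := by
  obtain ⟨c, hc0, hc1, hc⟩ := S.exists_bound_functionals ht ht'
  set κ : ℝ := (2⁻¹ : ℝ) ^ t.card * c with hκ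
  have hκ0 : 0 < κ := by positivity
  refine ⟨ENNReal.ofReal (((κ ^ 3 / 2) ^ L)⁻¹), ENNReal.ofReal_ne_top, fun ζ x h hh => ?_⟩
  rw [S.coord_of_mem _ _ _ hh, kernel_eq, ← ofReal_norm, norm_halfPlaneKernel]
  set P := ∏ l ∈ t, ‖1 - Complex.I * (1 : ℝ) *
    Complexification.extend l (Complexification.ofReIm x (S.quad ζ + h))‖ with hP
  have h1 : κ * (1 + (‖x‖ + (‖h‖ + ‖ζ‖ ^ 2))) ≤ P := by
    refine le_trans ?_ (sum_le_prod_norm fun l hl => functional_im_pos ht ζ hh hl)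
    rw [hκ, mul_assoc]
    refine mul_le_mul_of_nonneg_left ?_ (by positivity)
    have := hc ζ x h hh
    simp only [Complexification.extend_re, Complexification.extend_im,
      Complexification.re_ofReIm, Complexification.im_ofReIm]
    linarith
  have hx := norm_nonneg x
  have hh0 := norm_nonneg h
  have hz := norm_nonneg ζ
  have hz2 : (1 + ‖ζ‖) / 2 ≤ 1 + ‖ζ‖ ^ 2 := by nlinarith [sq_nonneg (‖ζ‖ - 1)]
  set T := 1 + (‖x‖ + (‖h‖ + ‖ζ‖ ^ 2)) with hT
  have hT1 : 1 + ‖x‖ ≤ T := by nlinarith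
  have hT2 : 1 + ‖h‖ ≤ T := by nlinarith
  have hT3 : (1 + ‖ζ‖) / 2 ≤ T := by linarith
  have h2 : κ ^ 3 / 2 * ((1 + ‖ζ‖) * (1 + ‖x‖) * (1 + ‖h‖)) ≤ P ^ 3 := by
    calc κ ^ 3 / 2 * ((1 + ‖ζ‖) * (1 + ‖x‖) * (1 + ‖h‖))
        = κ ^ 3 * ((1 + ‖ζ‖) / 2 * (1 + ‖x‖) * (1 + ‖h‖)) := by ring
      _ ≤ κ ^ 3 * (T * T * T) := by gcongr
      _ = (κ * T) ^ 3 := by ring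
      _ ≤ P ^ 3 := by gcongr
  have h3 : (P ^ (3 * L))⁻¹ ≤
      ((κ ^ 3 / 2) ^ L)⁻¹ * ((1 + ‖ζ‖) ^ (-(L : ℝ)) * (1 + ‖x‖) ^ (-(L : ℝ)) *
        (1 + ‖h‖) ^ (-(L : ℝ))) := by
    rw [Real.rpow_neg (by positivity), Real.rpow_neg (by positivity), Real.rpow_neg (by positivity),
      Real.rpow_natCast, Real.rpow_natCast, Real.rpow_natCast, ← mul_inv, ← mul_inv, ← mul_inv,
      ← mul_pow, ← mul_pow, ← mul_pow, pow_mul]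
    gcongr
  refine (ENNReal.ofReal_le_ofReal h3).trans_eq ?_
  rw [ENNReal.ofReal_mul (by positivity), ENNReal.ofReal_mul (by positivity),
    ENNReal.ofReal_mul (by positivity)]
  rfl

theorem nonempty_functionals [Nontrivial E] (ht : ∀ l ∈ t, ∀ y ∈ S.Ω, 0 < l y)
    (ht' : ∀ v, (∀ l ∈ t, l v = 0) → v = 0) : t.Nonempty := by
  rw [Finset.nonempty_iff_ne_empty]
  rintro rfl
  obtain ⟨ζ, hζ⟩ := exists_ne (0 : E)
  exact hζ (S.eq_zero_of_functional_quad ht ht' (by simp))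

/-- Two dilation norms of different degrees are not comparable on holomorphic functions. -/
theorem exists_holomorphic_separating [Nontrivial E] {N₁ N₂ : (E → F → F → ℝ≥0∞) → ℝ≥0∞} {α β : ℝ}
    (h₁ : S.IsDilationNorm N₁ α) (h₂ : S.IsDilationNorm N₂ β) (hα : 0 ≤ α) (hne : α ≠ β) :
    ∃ f : E × Complexification F → ℂ, DifferentiableOn ℂ f S.domain ∧
      N₁ (S.coord f) < ∞ ∧ N₂ (S.coord f) = ∞ := by
  obtain ⟨t, ht, ht'⟩ := S.exists_finset_functionals
  have htne := nonempty_functionals ht ht'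
  obtain ⟨L₀, hL₀⟩ := h₁.finite
  obtain ⟨L, hL⟩ := exists_nat_ge (max L₀ α)
  have hM : α ≤ (3 * L : ℕ) := by
    have h1 := (le_max_right _ _).trans hL
    push_cast
    linarith
  set M := 3 * L with hMdef
  have hfin : N₁ (S.coord (kernel E t M 1)) < ∞ := by
    obtain ⟨C, hC, hle⟩ := exists_coord_kernel_le ht ht' L
    refine (h₁.mono _ _ hle).trans_lt ?_
    rw [h₁.const_mul C hC]
    exact ENNReal.mul_lt_top hC.lt_top (hL₀ L ((le_max_left _ _).trans hL))
  -- With `δ k = 128 ^ (-k)`, the `k`-th term has first norm of order `128 ^ (-k)`, still summable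
  -- against the weights `64 ^ k`. Its second norm is of order `128 ^ (-k) * a k ^ (α - β) = 2 ^ k`.
  -- The sign of `α - β` is immaterial.
  let a : ℕ → ℝ := fun k => (256 : ℝ) ^ (k / (α - β))
  have ha : ∀ k, 0 < a k := fun k => by positivity
  have hab : ∀ k, a k ^ (α - β) = 256 ^ k := fun k => by
    rw [← Real.rpow_mul (by norm_num), div_mul_cancel₀ _ (sub_ne_zero.2 hne), Real.rpow_natCast]
  let δ : ℕ → ℝ := fun k => (128⁻¹ : ℝ) ^ k
  have hδ : Summable δ := summable_geometric_of_lt_one (by norm_num) (by norm_num)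
  have hδ0 : ∀ k, 0 ≤ δ k := fun k => by positivity
  let c : ℕ → ℝ := fun k => δ k * a k ^ α
  have hc0 : ∀ k, 0 ≤ c k := fun k => mul_nonneg (hδ0 k) (Real.rpow_nonneg (ha k).le _)
  let f : E × Complexification F → ℂ := fun w => ∑' k, (c k : ℂ) * kernel E t M (a k) w
  have hf : ∀ w ∈ S.domain, (Summable fun k => (c k : ℂ) * kernel E t M (a k) w) ∧
      DifferentiableAt ℂ f w := fun w hw =>
    differentiableAt_tsum_halfPlaneKernel (fun l : F →L[ℝ] ℝ => (Complexification.extend l).comp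
      (ContinuousLinearMap.snd ℂ E (Complexification F))) hα hM ha hδ hδ0 htne
      fun l hl => functional_im_pos_of_mem_domain ht hw hl
  refine ⟨f, fun w hw => (hf w hw).2.differentiableWithinAt, ?_, ?_⟩
  · obtain ⟨C, hC, htsum⟩ := h₁.tsum_le
    let K : ℕ → E → F → F → ℝ≥0∞ := fun k ζ x h =>
      ENNReal.ofReal (c k) * S.coord (kernel E t M (a k)) ζ x h
    have hK : ∀ k, Measurable fun w : E × F × F => K k w.1 w.2.1 w.2.2 := fun k =>
      (S.measurable_coord (continuousOn_kernel ht (ha k))).const_mul _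
    have hle : N₁ (S.coord f) ≤ N₁ fun ζ x h => ∑' k, K k ζ x h := by
      refine h₁.mono _ _ fun ζ x h hh => ?_
      rw [S.coord_of_mem _ _ _ hh]
      refine enorm_tsum_le_tsum_enorm.trans (ENNReal.tsum_le_tsum fun k => ?_)
      rw [enorm_mul, ← ofReal_norm (c k : ℂ), Complex.norm_real, Real.norm_of_nonneg (hc0 k)]
      exact (congrArg _ (S.coord_of_mem _ _ _ hh).symm).le
    have hNK : ∀ k, 64 ^ k * N₁ (K k) ≤ 2⁻¹ ^ k * N₁ (S.coord (kernel E t M 1)) := by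
      intro k
      have e1 : N₁ (S.coord (kernel E t M (a k))) ≤
          ENNReal.ofReal (a k ^ (-α)) * N₁ (S.coord (kernel E t M 1)) := by
        rw [← h₁.dilate (a k) (ha k)]
        exact h₁.mono _ _ fun ζ x h hh => (coord_kernel_dilate t M (ha k) ζ x hh).le
      calc 64 ^ k * N₁ (K k)
          = 64 ^ k * (ENNReal.ofReal (c k) * N₁ (S.coord (kernel E t M (a k)))) := by
            rw [h₁.const_mul _ ENNReal.ofReal_ne_top]
        _ ≤ 64 ^ k * (ENNReal.ofReal (c k) *
            (ENNReal.ofReal (a k ^ (-α)) * N₁ (S.coord (kernel E t M 1)))) := by gcongr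
        _ = 2⁻¹ ^ k * N₁ (S.coord (kernel E t M 1)) := by
            rw [← mul_assoc, ← mul_assoc]
            congr 1
            have e2 : (64 : ℝ≥0∞) ^ k = ENNReal.ofReal (64 ^ k) := by
              rw [ENNReal.ofReal_pow (by norm_num)]; norm_num
            have e3 : (2⁻¹ : ℝ≥0∞) ^ k = ENNReal.ofReal (2⁻¹ ^ k) := by
              rw [ENNReal.ofReal_pow (by norm_num), ENNReal.ofReal_inv_of_pos two_pos]
              norm_num
            rw [e2, e3, ← ENNReal.ofReal_mul (by positivity), ← ENNReal.ofReal_mul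
              (mul_nonneg (by positivity) (hc0 k))]
            congr 1
            change 64 ^ k * (128⁻¹ ^ k * a k ^ α) * a k ^ (-α) = 2⁻¹ ^ k
            rw [← mul_assoc, mul_assoc, ← Real.rpow_add (ha k), add_neg_cancel, Real.rpow_zero,
              mul_one, ← mul_pow]
            norm_num
    refine (hle.trans (htsum K hK)).trans_lt ?_
    refine (mul_le_mul_right (ENNReal.tsum_le_tsum hNK) C).trans_lt ?_
    rw [ENNReal.tsum_mul_right, ENNReal.tsum_geometric_two]
    exact ENNReal.mul_lt_top hC.lt_top (ENNReal.mul_lt_top (by simp) hfin)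
  · by_contra hfin₂
    have hN0 := h₂.sectorKernel_ne_zero (M := M) ht
    -- On the sector no term can be cancelled by the others, so `f` dominates every single dilate
    -- there.
    have hpt : ∀ k, ∀ ζ x, ∀ h ∈ S.Ω, ENNReal.ofReal (c k) *
        S.sectorKernel t M (√(a k) • ζ) (a k • x) (a k • h) ≤ 2 * S.coord f ζ x h := by
      intro k ζ x h hh
      by_cases hsec : (√(a k) • ζ, a k • x, a k • h) ∈ {w : E × F × F | ∀ l ∈ t,
          |l w.2.1| < aperture t M * l (S.quad w.1 + w.2.2)}
      swap
      · rw [sectorKernel, indicator_of_notMem hsec, mul_zero]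
        exact zero_le
      rw [sectorKernel, indicator_of_mem hsec, ← coord_kernel_dilate t M (ha k) ζ x hh,
        S.coord_of_mem _ _ _ hh, S.coord_of_mem _ _ _ hh]
      set w : E × Complexification F := (ζ, Complexification.ofReIm x (S.quad ζ + h)) with hw
      -- The sector is invariant under dilations: `a k` cancels, so membership for one index serves
      -- all of them.
      have hsec' : ∀ l ∈ t, |l x| ≤ aperture t M * l (S.quad ζ + h) := by
        intro l hl
        have h0 := hsec l hl
        simp only [S.quad_smul, Real.sq_sqrt (ha k).le, map_smul, map_add, smul_eq_mul, abs_mul,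
          abs_of_pos (ha k)] at h0
        rw [map_add]
        have h1 : a k * |l x| < a k * (aperture t M * (l (S.quad ζ) + l h)) := by linarith
        exact (lt_of_mul_lt_mul_left h1 (ha k).le).le
      have hker : ∀ j, ‖kernel E t M (a j) w‖ ≤ 2 * (kernel E t M (a j) w).re := fun j =>
        norm_halfPlaneKernel_le_two_mul_re (ha j) (fun l hl => functional_im_pos ht ζ hh hl) hsec'
      have hsum := (hf w (S.mem_domain_coord ζ x hh)).1
      -- All real parts are nonnegative at this point, so the sum of the real parts is at least any
      -- one of them.
      have hre : c k * (kernel E t M (a k) w).re ≤ (f w).re := by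
        have hs : HasSum (fun j => c j * (kernel E t M (a j) w).re) (f w).re := by
          simpa only [Complex.re_ofReal_mul] using Complex.hasSum_re hsum.hasSum
        refine le_hasSum hs k fun j _ => mul_nonneg (hc0 j) ?_
        linarith [hker j, norm_nonneg (kernel E t M (a j) w)]
      have hfin : c k * ‖kernel E t M (a k) w‖ ≤ 2 * ‖f w‖ := by
        have h1 := mul_le_mul_of_nonneg_left (hker k) (hc0 k)
        have h2 := Complex.re_le_norm (f w)
        linarith
      rw [← ofReal_norm, ← ofReal_norm, ← ENNReal.ofReal_mul (hc0 k),
        ← ENNReal.ofReal_ofNat, ← ENNReal.ofReal_mul (by norm_num)]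
      exact ENNReal.ofReal_le_ofReal hfin
    have hlow : ∀ k : ℕ, 2 ^ k * N₂ (S.sectorKernel t M) ≤ 2 * N₂ (S.coord f) := by
      intro k
      have e1 := h₂.mono _ _ (hpt k)
      rw [h₂.const_mul _ ENNReal.ofReal_ne_top, h₂.const_mul 2 (by simp), h₂.dilate (a k) (ha k),
        ← mul_assoc, ← ENNReal.ofReal_mul (hc0 k)] at e1
      refine le_of_eq_of_le ?_ e1
      congr 1
      have e2 : c k * a k ^ (-β) = 2 ^ k := by
        change 128⁻¹ ^ k * a k ^ α * a k ^ (-β) = 2 ^ k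
        rw [mul_assoc, ← Real.rpow_add (ha k), ← sub_eq_add_neg, hab, ← mul_pow]
        norm_num
      rw [e2, ENNReal.ofReal_pow (by norm_num)]
      norm_num
    obtain ⟨n, hn⟩ := ENNReal.exists_nat_mul_gt hN0
      (ENNReal.mul_ne_top (by simp : (2 : ℝ≥0∞) ≠ ∞) hfin₂)
    refine absurd hn (not_lt.2 (le_trans ?_ (hlow n)))
    gcongr
    exact_mod_cast Nat.lt_two_pow_self.le

end

end SiegelDomain

end

/-! ### Comparison of the degrees and conclusion. -/

noncomputable section

namespace SiegelDomain.TriangularGroup.PowerCharacter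

variable {E F : Type*} [NormedAddCommGroup E] [InnerProductSpace ℂ E]
  [NormedAddCommGroup F] [InnerProductSpace ℝ F] {r : ℕ}

/-- The degrees differ by `dim_ℝ E / 2` times the difference of the inverse exponents, and inversion
is injective on `(0, ∞]` with real values. -/
theorem degreeA_ne_degreeB [FiniteDimensional ℂ E] [Nontrivial E] {p q : ℝ≥0∞} (hp : p ≠ 0)
    (hq : q ≠ 0) (hpq : p ≠ q) (s : Fin r → ℝ) : degreeA E F p s ≠ degreeB E F p q s := by
  intro h
  have hE : (0 : ℝ) < Module.finrank ℝ E := Nat.cast_pos.2 Module.finrank_pos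
  have h1 : p⁻¹.toReal = q⁻¹.toReal :=
    mul_left_cancel₀ (half_pos hE).ne' (add_left_cancel h)
  rw [ENNReal.toReal_eq_toReal_iff' (by simpa using hp) (by simpa using hq), inv_inj] at h1
  exact hpq h1

theorem degreeA_nonneg {p : ℝ≥0∞} {s : Fin r → ℝ} (hs : 0 ≤ ∑ j, s j) : 0 ≤ degreeA E F p s := by
  unfold degreeA
  positivity

theorem degreeB_nonneg {p q : ℝ≥0∞} {s : Fin r → ℝ} (hs : 0 ≤ ∑ j, s j) :
    0 ≤ degreeB E F p q s := by
  unfold degreeB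
  positivity

variable [FiniteDimensional ℂ E] [MeasurableSpace E] [BorelSpace E]
  [FiniteDimensional ℝ F] [MeasurableSpace F] [BorelSpace F]
  {S : SiegelDomain E F} {G : S.TriangularGroup} (P : G.PowerCharacter r)
  {d b : Fin r → ℝ} {p q : ℝ≥0∞} {s : Fin r → ℝ}

theorem mem_bergmanA_iff {f : E × Complexification F → ℂ} :
    f ∈ P.bergmanA d p q s ↔
      DifferentiableOn ℂ f S.domain ∧ P.normA d p q s (S.coord f) < ∞ := by
  rw [← P.bergmanNorm_eq]
  rfl

theorem mem_bergmanCal_iff {f : E × Complexification F → ℂ} :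
    f ∈ P.bergmanCal d p q s ↔
      DifferentiableOn ℂ f S.domain ∧ P.normB d p q s (S.coord f) < ∞ := by
  rw [← P.bergmanCal_norm_eq]
  rfl

theorem bergmanFrakWeighted_eq (hp : p ≠ 0) (hq : q ≠ 0) :
    P.bergmanFrakWeighted d b p q s =
      P.bergmanCal d p q (q⁻¹.toReal • (s + (1 / 2 : ℝ) • b)) := by
  ext f
  rw [P.mem_bergmanCal_iff]
  refine and_congr_right fun hf => ?_
  rw [P.bergmanFrakWeighted_norm_eq hp hq hf.continuousOn]

theorem bergmanA_eq_bergmanCal (hp : p ≠ 0) (hq : q ≠ 0) (h : p = q ∨ Subsingleton E) :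
    P.bergmanA d p q s = P.bergmanCal d p q s := by
  ext f
  rw [P.mem_bergmanA_iff, P.mem_bergmanCal_iff]
  refine and_congr_right fun hf => ?_
  have hK := S.measurable_coord hf.continuousOn
  rcases h with rfl | hE
  · rw [P.normA_eq_normB hK hp]
  · exact P.normA_lt_top_iff_of_subsingleton hK hp hq

/-- The separation result is symmetric in the two norms once both degrees are nonnegative, so it is
applied in both orders. -/
theorem not_subset_of_ne [Nontrivial E] (hdb : P.IsInvariantExponents d b) (hp : p ≠ 0)
    (hq : q ≠ 0) (hpq : p ≠ q) (hfin : P.coneNorm d q s unitBall < ∞) :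
    ¬ P.bergmanA d p q s ⊆ P.bergmanCal d p q s ∧
      ¬ P.bergmanCal d p q s ⊆ P.bergmanA d p q s := by
  have hA := P.isDilationNorm_normA (p := p) hdb hp hq hfin
  have hB := P.isDilationNorm_normB (p := p) hdb hp hq hfin
  have hne := degreeA_ne_degreeB (E := E) (F := F) hp hq hpq s
  have hs := P.sum_exponent_nonneg hdb hq hfin
  constructor
  · intro hsub
    obtain ⟨f, hf, h1, h2⟩ := exists_holomorphic_separating hA hB (degreeA_nonneg hs) hne
    exact ((P.mem_bergmanCal_iff.1 (hsub (P.mem_bergmanA_iff.2 ⟨hf, h1⟩))).2).ne h2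
  · intro hsub
    obtain ⟨f, hf, h1, h2⟩ := exists_holomorphic_separating hB hA (degreeB_nonneg hs) hne.symm
    exact ((P.mem_bergmanA_iff.1 (hsub (P.mem_bergmanCal_iff.2 ⟨hf, h1⟩))).2).ne h2

end SiegelDomain.TriangularGroup.PowerCharacter

end

theorem lemma4p2 {E F : Type*} [NormedAddCommGroup E] [InnerProductSpace ℂ E]
    [FiniteDimensional ℂ E] [MeasurableSpace E] [BorelSpace E]
    [NormedAddCommGroup F] [InnerProductSpace ℝ F]
    [FiniteDimensional ℝ F] [MeasurableSpace F] [BorelSpace F]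
    (S : SiegelDomain E F) (G : S.TriangularGroup) {r : ℕ} (P : G.PowerCharacter r)
    (d b m : Fin r → ℝ) (hdb : P.IsInvariantExponents d b) (hm : P.IsRadonExponent d m)
    (p q : ℝ≥0∞) (hp : p ≠ 0) (hq : q ≠ 0) (s : Fin r → ℝ) :
    (P.bergmanFrak d b p q s =
        P.bergmanCal d p q (q⁻¹.toReal • (s + (1 / 2 : ℝ) • b)) ∧
      P.bergmanFrakWeighted d b p q s =
        P.bergmanCal d p q (q⁻¹.toReal • (s + (1 / 2 : ℝ) • b))) ∧
    ((∀ j, (2 * q)⁻¹.toReal * m j < s j) ∨ (q = ∞ ∧ ∀ j, 0 ≤ s j) →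
      (P.bergmanA d p q s = P.bergmanCal d p q s ↔ p = q ∨ Subsingleton E) ∧
      (¬ (p = q ∨ Subsingleton E) →
        ¬ P.bergmanA d p q s ⊆ P.bergmanCal d p q s ∧
        ¬ P.bergmanCal d p q s ⊆ P.bergmanA d p q s)) := by
  refine ⟨⟨rfl, P.bergmanFrakWeighted_eq hp hq⟩, fun hs => ?_⟩
  have hnot : ¬ (p = q ∨ Subsingleton E) →
      ¬ P.bergmanA d p q s ⊆ P.bergmanCal d p q s ∧
        ¬ P.bergmanCal d p q s ⊆ P.bergmanA d p q s := by
    intro h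
    rw [not_or, not_subsingleton_iff_nontrivial] at h
    have := h.2
    exact P.not_subset_of_ne hdb hp hq h.1 (P.coneNorm_unitBall_lt_top hm hq hs)
  refine ⟨⟨fun heq => ?_, P.bergmanA_eq_bergmanCal hp hq⟩, hnot⟩
  by_contra h
  exact (hnot h).1 heq.subset
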